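/- Let $\alpha,\beta\in\mathbb C$ be such that $\alpha+n+m\beta\neq 0$ for all $n,m\in\mathbb Z\setminus\{0\}$. Let $\mathcal L=\mathcal L_{\alpha,\beta,0}$ be the complex Lie algebra with basis $L_m,J_m,G_m$ $(m\in\mathbb Z)$, $C_1,C_2,C_3$, where $C_1,C_2,C_3$ are central and, for $m,n\in\mathbb Z$, $$[L_m,L_n]=(m-n)L_{m+n}+\tfrac{m^3-m}{12}\delta_{m+n,0}C_1,\qquad [L_m,J_n]=-nJ_{m+n}-(m^2+m)\delta_{m+n,0}C_2,$$ $$[J_m,J_n]=m\delta_{m+n,0}C_3,\quad [L_m,G_n]=-(\alpha+n+m\beta)G_{m+n},\quad [J_m,G_n]=0,\quad [G_m,G_n]=0.$$ For $\underline d=(d_1,d_2)\in\mathbb Z_{\ge 0}^2$ let $\mathcal L_{\underline d}$ be the subalgebra spanned by $L_i,\ G_{-d_1+i},\ J_{-d_2+i}$ $(i\ge 0)$ and $C_1,C_2,C_3$. An $\mathcal L$-module $S$ is called restricted if for every $w\in S$ one has $L_mw=J_mw=G_mw=0$ for all sufficiently large $m$. Theorem. Let $S$ be a simple restricted $\mathcal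 L$-module on which $C_3$ acts as a nonzero scalar, and suppose that $G_a$ acts injectively on $S$ for some integer $a\ge 0$. Then there are $\underline d=(d_1,d_2)\in\mathbb Z_{\ge 0}^2$ and a simple $\mathcal L_{\underline d}$-module $V$, on which $C_1,C_2,C_3$ act as scalars, that of $C_3$ being nonzero, such that for some integer $k\ge 0$ (a) $G_k$ acts injectively on $V$, (b) $G_{k+i}V=J_{d_2+i}V=L_{k+d_1+i}V=0$ for all integers $i\ge 1$, and such that $S\cong \mathrm{Ind}_{\mathcal L_{\underline d}}^{\mathcal L}(V)=U(\mathcal L)\otimes_{U(\mathcal L_{\underline d})}V$ as $\mathcal L$-modules. -/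

import Mathlib

open scoped TensorProduct

universe u

noncomputable section

namespace EHV

/-- The index set of the standard basis `L_m, J_m, G_m (m ∈ ℤ), C₁, C₂, C₃`. -/
inductive Gen : Type
  | L (m : ℤ)
  | J (m : ℤ)
  | G (m : ℤ)
  | C₁
  | C₂
  | C₃

/-- The underlying vector space of the extended Heisenberg-Virasoro algebra
`𝓛_{α,β,F}`: the complex vector space with basis `Gen`. -/
def Alg (_α _β _F : ℂ) : Type := Gen →₀ ℂ

variable (α β F : ℂ)

instance : AddCommGroup (Alg α β F) := inferInstanceAs (AddCommGroup (Gen →₀ ℂ))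
instance : Module ℂ (Alg α β F) := inferInstanceAs (Module ℂ (Gen →₀ ℂ))

/-- The basis element with index `g`. -/
def gen (g : Gen) : Alg α β F := (Finsupp.single g 1 : Gen →₀ ℂ)

/-- The basis element `L_m`. -/
def L (m : ℤ) : Alg α β F := gen α β F (.L m)

/-- The basis element `J_m`. -/
def J (m : ℤ) : Alg α β F := gen α β F (.J m)

/-- The basis element `G_m`. -/
def G (m : ℤ) : Alg α β F := gen α β F (.G m)

/-- The central basis element `C₁`. -/
def C₁ : Alg α β F := gen α β F .C₁

/-- The central basis element `C₂`. -/
def C₂ : Alg α β F := gen α β F .C₂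

/-- The central basis element `C₃`. -/
def C₃ : Alg α β F := gen α β F .C₃

/-- `δ_{m,0}` as a complex number. -/
def delta (m : ℤ) : ℂ := if m = 0 then 1 else 0

/-- The brackets of the basis elements. -/
def genBracket : Gen → Gen → Alg α β F
  | .L m, .L n => ((m : ℂ) - n) • L α β F (m + n)
      + (((m : ℂ) ^ 3 - m) / 12 * delta (m + n)) • C₁ α β F
  | .L m, .J n => (-(n : ℂ)) • J α β F (m + n)
      - (((m : ℂ) ^ 2 + m) * delta (m + n)) • C₂ α β F
  | .J m, .L n => (m : ℂ) • J α β F (m + n)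
      + (((n : ℂ) ^ 2 + n) * delta (m + n)) • C₂ α β F
  | .J m, .J n => ((m : ℂ) * delta (m + n)) • C₃ α β F
  | .L m, .G n => (-(α + n + m * β)) • G α β F (m + n)
  | .G m, .L n => (α + m + n * β) • G α β F (m + n)
  | .J m, .G n => F • G α β F (m + n)
  | .G m, .J n => (-F) • G α β F (m + n)
  | _, _ => 0

/-- The standard basis. -/
def basis : Module.Basis Gen ℂ (Alg α β F) := Module.Basis.ofRepr (LinearEquiv.refl ℂ (Gen →₀ ℂ))

@[simp] theorem basis_apply (g : Gen) : basis α β F g = gen α β F g := rfl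

/-- The bilinear extension of `genBracket`. -/
def bracket : Alg α β F →ₗ[ℂ] Alg α β F →ₗ[ℂ] Alg α β F :=
  (basis α β F).constr ℂ fun g => (basis α β F).constr ℂ fun h => genBracket α β F g h

@[simp] theorem bracket_gen (g h : Gen) :
    bracket α β F (gen α β F g) (gen α β F h) = genBracket α β F g h := by
  rw [← basis_apply, ← basis_apply, bracket, Module.Basis.constr_basis, Module.Basis.constr_basis]

theorem bracket_skew (x y : Alg α β F) : bracket α β F x y = -bracket α β F y x := by
  have h : bracket α β F = -(bracket α β F).flip := by
    refine (basis α β F).ext fun g => (basis α β F).ext fun h => ?_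
    simp only [basis_apply, bracket_gen, LinearMap.neg_apply, LinearMap.flip_apply]
    rcases g with m | m | m | _ | _ | _ <;> rcases h with n | n | n | _ | _ | _ <;>
      simp only [genBracket, neg_zero] <;> rw [add_comm n m]
    · by_cases h : m + n = 0
      · obtain rfl : n = -m := by omega
        simp only [delta]
        push_cast
        module
      · simp only [delta, h, if_false]
        module
    case J.J =>
      by_cases h : m + n = 0
      · obtain rfl : n = -m := by omega
        simp only [delta]
        push_cast
        module
      · simp only [delta, h, if_false]
        module
    all_goals module
  exact congrArg (fun f => f x y) h

theorem bracket_self (x : Alg α β F) : bracket α β F x x = 0 := by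
  have h := bracket_skew α β F x x
  have h2 : (2 : ℂ) • bracket α β F x x = 0 := by
    rw [two_smul]; nth_rewrite 1 [h]; simp
  exact (smul_eq_zero.mp h2).resolve_left two_ne_zero

theorem bracket_jacobi_gen (a b c : Gen) :
    bracket α β F (gen α β F a) (genBracket α β F b c) =
      bracket α β F (genBracket α β F a b) (gen α β F c) +
        bracket α β F (gen α β F b) (genBracket α β F a c) := by
  rcases a with m | m | m | _ | _ | _ <;> rcases b with n | n | n | _ | _ | _ <;>
    rcases c with p | p | p | _ | _ | _ <;>
    simp only [genBracket, map_zero, LinearMap.zero_apply, add_zero, zero_add, map_add, map_sub,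
      map_smul, LinearMap.add_apply, LinearMap.sub_apply, LinearMap.smul_apply, L, J, G, C₁, C₂, C₃,
      bracket_gen, smul_zero, sub_zero]
  all_goals try rw [add_left_comm n m p]
  all_goals
    try rw [← add_assoc m n p]
    by_cases h : m + n + p = 0
    · obtain rfl : p = -m - n := by omega
      try simp only [delta]
      push_cast
      module
    · try simp only [delta, h, if_false]
      push_cast
      module

variable {α β F} in
theorem gen_induction {p : Alg α β F → Prop} (hgen : ∀ g, p (gen α β F g))
    (hadd : ∀ x y, p x → p y → p (x + y)) (hsmul : ∀ (c : ℂ) x, p x → p (c • x))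
    (x : Alg α β F) : p x := by
  have hx : x ∈ Submodule.span ℂ (Set.range (basis α β F)) := by
    rw [(basis α β F).span_eq]; trivial
  induction hx using Submodule.span_induction with
  | mem x h => obtain ⟨g, rfl⟩ := h; exact hgen g
  | zero => simpa using hsmul 0 _ (hgen .C₁)
  | add x y _ _ hx hy => exact hadd x y hx hy
  | smul c x _ hx => exact hsmul c x hx

theorem bracket_jacobi (x y z : Alg α β F) :
    bracket α β F x (bracket α β F y z) =
      bracket α β F (bracket α β F x y) z + bracket α β F y (bracket α β F x z) := by
  induction x using gen_induction with
  | hadd x₁ x₂ h₁ h₂ => simp only [map_add, LinearMap.add_apply, h₁, h₂]; abel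
  | hsmul c x h => simp only [map_smul, LinearMap.smul_apply, h, smul_add]
  | hgen a =>
    induction y using gen_induction with
    | hadd x₁ x₂ h₁ h₂ => simp only [map_add, LinearMap.add_apply, h₁, h₂]; abel
    | hsmul c x h => simp only [map_smul, LinearMap.smul_apply, h, smul_add]
    | hgen b =>
      induction z using gen_induction with
      | hadd x₁ x₂ h₁ h₂ => simp only [map_add, h₁, h₂]; abel
      | hsmul c x h => simp only [map_smul, h, smul_add]
      | hgen c => simpa using bracket_jacobi_gen α β F a b c

/-- The Lie bracket of `𝓛_{α,β,F}`. -/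
instance : LieRing (Alg α β F) where
  bracket x y := bracket α β F x y
  add_lie x y z := by simp
  lie_add x y z := by simp
  lie_self x := bracket_self α β F x
  leibniz_lie x y z := bracket_jacobi α β F x y z

instance : LieAlgebra ℂ (Alg α β F) where
  lie_smul c x y := (bracket α β F x).map_smul c y

theorem lie_def (x y : Alg α β F) : ⁅x, y⁆ = bracket α β F x y := rfl

/-- The indices of the basis of `𝓛_{(d₁,d₂)}`: those of `L_i, G_{-d₁+i}, J_{-d₂+i}` with `i ≥ 0`
and of `C₁, C₂, C₃`. -/
def InSub (d₁ d₂ : ℕ) : Gen → Prop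
  | .L m => 0 ≤ m
  | .G m => -(d₁ : ℤ) ≤ m
  | .J m => -(d₂ : ℤ) ≤ m
  | _ => True

/-- The subalgebra `𝓛_{(d₁,d₂)}` of `𝓛_{α,β,0}`. -/
def sub (d₁ d₂ : ℕ) : LieSubalgebra ℂ (Alg α β 0) where
  toSubmodule := Submodule.span ℂ (gen α β 0 '' {g | InSub d₁ d₂ g})
  lie_mem' {x y} hx hy := by
    change x ∈ Submodule.span ℂ _ at hx
    change y ∈ Submodule.span ℂ _ at hy
    change ⁅x, y⁆ ∈ Submodule.span ℂ _
    have key : ∀ g, InSub d₁ d₂ g →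
        gen α β 0 g ∈ Submodule.span ℂ (gen α β 0 '' {g | InSub d₁ d₂ g}) :=
      fun g hg => Submodule.subset_span ⟨g, hg, rfl⟩
    induction hx, hy using Submodule.span_induction₂ with
    | mem_mem x y hx hy =>
      obtain ⟨g, hg, rfl⟩ := hx
      obtain ⟨h, hh, rfl⟩ := hy
      rw [lie_def, bracket_gen]
      simp only [Set.mem_ofPred_eq] at hg hh
      rcases g with m | m | m | _ | _ | _ <;> rcases h with n | n | n | _ | _ | _ <;>
        simp only [genBracket, neg_zero, zero_smul, Submodule.zero_mem] <;>
        simp only [InSub] at hg hh <;>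
        repeat' first
          | apply Submodule.add_mem
          | apply Submodule.sub_mem
          | apply Submodule.smul_mem
      all_goals
        refine key _ ?_
        simp only [InSub]
        try omega
    | zero_left y _ => simp
    | zero_right x _ => simp
    | add_left x y z _ _ _ h₁ h₂ => rw [add_lie]; exact Submodule.add_mem _ h₁ h₂
    | add_right x y z _ _ _ h₁ h₂ => rw [lie_add]; exact Submodule.add_mem _ h₁ h₂
    | smul_left c x y _ _ h => rw [smul_lie]; exact Submodule.smul_mem _ c h
    | smul_right c x y _ _ h => rw [lie_smul]; exact Submodule.smul_mem _ c h

theorem gen_mem_sub {d₁ d₂ : ℕ} {g : Gen} (hg : InSub d₁ d₂ g) : gen α β 0 g ∈ sub α β d₁ d₂ :=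
  Submodule.subset_span ⟨g, hg, rfl⟩

/-- A basis element as an element of the subalgebra `𝓛_{(d₁,d₂)}`. -/
def subGen (d₁ d₂ : ℕ) (g : Gen) (hg : InSub d₁ d₂ g) : sub α β d₁ d₂ :=
  ⟨gen α β 0 g, gen_mem_sub α β hg⟩

/-- `C₁, C₂, C₃` act on the `𝓛_{(d₁,d₂)}`-module `V` as scalars, that of `C₃` being nonzero. -/
def HasLevel (d₁ d₂ : ℕ) (V : Type*) [AddCommGroup V] [Module ℂ V]
    [LieRingModule (sub α β d₁ d₂) V] : Prop :=
  ∃ ℓ₁ ℓ₂ ℓ₃ : ℂ, ℓ₃ ≠ 0 ∧ ∀ v : V,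
    ⁅subGen α β d₁ d₂ .C₁ trivial, v⁆ = ℓ₁ • v ∧
    ⁅subGen α β d₁ d₂ .C₂ trivial, v⁆ = ℓ₂ • v ∧
    ⁅subGen α β d₁ d₂ .C₃ trivial, v⁆ = ℓ₃ • v

/-- `V` satisfies, for some `k ≥ 0`: `G_k` acts injectively on `V`, and
`G_{k+i} V = J_{d₂+i} V = L_{k+d₁+i} V = 0` for all `i ≥ 1`. -/
def InducingConditions (d₁ d₂ : ℕ) (V : Type*) [AddCommGroup V] [Module ℂ V]
    [LieRingModule (sub α β d₁ d₂) V] : Prop :=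
  ∃ k : ℕ,
    (Function.Injective fun v : V => ⁅subGen α β d₁ d₂ (.G k) (by simp only [InSub]; omega), v⁆) ∧
    ∀ i : ℕ, 1 ≤ i → ∀ v : V,
      ⁅subGen α β d₁ d₂ (.G (k + i)) (by simp only [InSub]; omega), v⁆ = 0 ∧
      ⁅subGen α β d₁ d₂ (.J (d₂ + i)) (by simp only [InSub]; omega), v⁆ = 0 ∧
      ⁅subGen α β d₁ d₂ (.L (k + d₁ + i)) (by simp only [InSub]; omega), v⁆ = 0

/-- A module `W` is restricted if every `w ∈ W` is killed by `L_m, J_m, G_m` for all large `m`. -/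
def IsRestricted (W : Type*) [AddCommGroup W] [Module ℂ W] [LieRingModule (Alg α β F) W] : Prop :=
  ∀ w : W, ∃ N : ℤ, ∀ m : ℤ, N ≤ m →
    ⁅L α β F m, w⁆ = 0 ∧ ⁅J α β F m, w⁆ = 0 ∧ ⁅G α β F m, w⁆ = 0

end EHV

namespace InducedModule

attribute [local instance 100] LieRing.ofAssociativeRing

variable {R A : Type*} [CommRing R] [LieRing A] [LieAlgebra R A] (H : LieSubalgebra R A)
  (V : Type*) [AddCommGroup V] [Module R V] [LieRingModule H V] [LieModule R H V]

/-- The algebra map `U(H) → U(A)` coming from the inclusion of `H` in `A`. -/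
def envMap : UniversalEnvelopingAlgebra R H →ₐ[R] UniversalEnvelopingAlgebra R A :=
  UniversalEnvelopingAlgebra.lift R ((UniversalEnvelopingAlgebra.ι R).comp H.incl)

/-- The action of `U(H)` on the `H`-module `V`. -/
def envAct : UniversalEnvelopingAlgebra R H →ₐ[R] Module.End R V :=
  UniversalEnvelopingAlgebra.lift R (LieModule.toEnd R H V)

/-- The `U(A)`-submodule of `U(A) ⊗[R] V` generated by the elements `u h ⊗ v - u ⊗ h v` with
`u ∈ U(A)`, `h ∈ U(H)`, `v ∈ V`. -/
def relations : Submodule (UniversalEnvelopingAlgebra R A)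
    (UniversalEnvelopingAlgebra R A ⊗[R] V) :=
  Submodule.span _ {t | ∃ (u : UniversalEnvelopingAlgebra R A)
    (h : UniversalEnvelopingAlgebra R H) (v : V),
    t = (u * envMap H h) ⊗ₜ[R] v - u ⊗ₜ[R] (envAct H V h v)}

/-- The induced module `Ind_H^A V = U(A) ⊗_{U(H)} V`: the tensor product over the noncommutative
ring `U(H)` is the quotient of `U(A) ⊗[R] V` by the relations `u h ⊗ v = u ⊗ h v`. -/
def Ind : Type _ := (UniversalEnvelopingAlgebra R A ⊗[R] V) ⧸ relations H V

instance : AddCommGroup (Ind H V) :=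
  inferInstanceAs (AddCommGroup ((UniversalEnvelopingAlgebra R A ⊗[R] V) ⧸ relations H V))

instance : Module (UniversalEnvelopingAlgebra R A) (Ind H V) :=
  inferInstanceAs (Module (UniversalEnvelopingAlgebra R A)
    ((UniversalEnvelopingAlgebra R A ⊗[R] V) ⧸ relations H V))

instance : Module R (Ind H V) :=
  inferInstanceAs (Module R ((UniversalEnvelopingAlgebra R A ⊗[R] V) ⧸ relations H V))

instance : IsScalarTower R (UniversalEnvelopingAlgebra R A) (Ind H V) :=
  inferInstanceAs (IsScalarTower R (UniversalEnvelopingAlgebra R A)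
    ((UniversalEnvelopingAlgebra R A ⊗[R] V) ⧸ relations H V))

/-- `A` acts on the induced module through left multiplication by `U(A)`. -/
instance : LieRingModule A (Ind H V) where
  bracket x w := UniversalEnvelopingAlgebra.ι R x • w
  add_lie x y w := by simp only [map_add, add_smul]
  lie_add x v w := by simp only [smul_add]
  leibniz_lie x y w := by
    simp only [LieHom.map_lie, LieRing.of_associative_ring_bracket, sub_smul, mul_smul]
    abel

instance : LieModule R A (Ind H V) where
  smul_lie c x w := by
    change UniversalEnvelopingAlgebra.ι R (c • x) • w = c • UniversalEnvelopingAlgebra.ι R x • w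
    rw [map_smul, smul_assoc]
  lie_smul c x w := by
    change UniversalEnvelopingAlgebra.ι R x • c • w = c • UniversalEnvelopingAlgebra.ι R x • w
    rw [← algebraMap_smul (UniversalEnvelopingAlgebra R A) c w,
      ← algebraMap_smul (UniversalEnvelopingAlgebra R A) c
        (UniversalEnvelopingAlgebra.ι R x • w), smul_smul, smul_smul, Algebra.commutes]

end InducedModule

end

/-! The module `V` is found inside `S`. Take the least `k ≥ 0` for which some nonzero vector is
killed by all `G_m` with `m > k`. Then `G_k` is injective on the space of all such vectors: for `k >
0` by minimality, for `k = 0` because some `G_a` with `a ≥ 0` is injective on `S`. For suitable `d₁,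
d₂`, let `V` be the space of vectors killed by `G_m` (`m > k`), `J_m` (`m > d₂`) and `L_m` (`m > k +
d₁`). It is nonzero because `S` is restricted, and it is stable under `𝓛_{(d₁,d₂)}` as soon as `2 d₂
≤ k + d₁`.

The heart is that ordered monomials in the remaining `L`, `J` and `G` are independent over `V`
(`injective_orderedMap`). Each such operator has a partner that acts on monomials like a partial
derivative, up to terms of lower degree: `G_{k+i+1}` for `L_{-i-1}`, `J_{d₂+i+1}` for `J_{-d₂-i-1}`,
and `L_{k+d₁+i+1}` for `G_{-d₁-i-1}`. The constants of differentiation are a nonzero multiple of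
`C₃` for `J`, and multiples of `G_k` for `L` and `G`, nonzero by the condition on `α, β`.
Differentiating down to degree zero kills any linear relation (`Differentiates.eq_zero_of_sum_mem`).

The same monomials applied to any stable subspace span a submodule (`lie_mem_range_orderedMap`).
Spanning in `S` and independence over `V` together make `V` simple. Spanning in the induced module
and independence in `S` make the canonical map from `Ind V` to `S` injective, so the
Poincaré–Birkhoff–Witt theorem is not needed. Finally, `C₁` and `C₂` act as scalars by Schur's lemma
in countable dimension. -/

open Module

namespace OrderedMonomials

/-! ### Words in a family of operators, and reordering them. -/

section Word

variable {I M : Type*} [AddCommGroup M] [Module ℂ M]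

/-- The composite of the operators `X i` along a list of indices. -/
def word (X : I → End ℂ M) (p : List I) : End ℂ M := (p.map X).prod

@[simp] theorem word_nil (X : I → End ℂ M) (v : M) : word X [] v = v := rfl

@[simp] theorem word_cons (X : I → End ℂ M) (i : I) (p : List I) (v : M) :
    word X (i :: p) v = X i (word X p v) := by
  simp [word]

/-- The span of all words in the operators `X i` applied to vectors of `U`. -/
def wordSpan (X : I → End ℂ M) (U : Submodule ℂ M) : Submodule ℂ M :=
  Submodule.span ℂ {m | ∃ p, ∃ u ∈ U, word X p u = m}

theorem le_wordSpan (X : I → End ℂ M) (U : Submodule ℂ M) : U ≤ wordSpan X U :=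
  fun u hu => Submodule.subset_span ⟨[], u, hu, rfl⟩

theorem apply_mem_wordSpan (X : I → End ℂ M) (U : Submodule ℂ M) (i : I) {m : M}
    (hm : m ∈ wordSpan X U) : X i m ∈ wordSpan X U := by
  have : wordSpan X U ≤ (wordSpan X U).comap (X i) := by
    refine Submodule.span_le.mpr ?_
    rintro _ ⟨p, u, hu, rfl⟩
    exact Submodule.subset_span ⟨i :: p, u, hu, by simp⟩
  exact this hm

theorem wordSpan_le {X : I → End ℂ M} {U W : Submodule ℂ M} (hU : U ≤ W)
    (hX : ∀ i, ∀ m ∈ W, X i m ∈ W) : wordSpan X U ≤ W := by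
  refine Submodule.span_le.mpr ?_
  rintro _ ⟨p, u, hu, rfl⟩
  induction p with
  | nil => exact hU hu
  | cons i p ih => rw [word_cons]; exact hX i _ ih

/-- The span of all words of length less than `n`. -/
def wordSpanLT (X : I → End ℂ M) (U : Submodule ℂ M) (n : ℕ) : Submodule ℂ M :=
  Submodule.span ℂ {m | ∃ p : List I, p.length < n ∧ ∃ u ∈ U, word X p u = m}

theorem apply_mem_wordSpanLT (X : I → End ℂ M) (U : Submodule ℂ M) (i : I) {n : ℕ} {m : M}
    (hm : m ∈ wordSpanLT X U n) : X i m ∈ wordSpanLT X U (n + 1) := by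
  have : wordSpanLT X U n ≤ (wordSpanLT X U (n + 1)).comap (X i) := by
    refine Submodule.span_le.mpr ?_
    rintro _ ⟨p, hp, u, hu, rfl⟩
    exact Submodule.subset_span ⟨i :: p, by simpa using hp, u, hu, by simp⟩
  exact this hm

/-- Swapping two adjacent letters costs a commutator, which is a combination of single letters; the
error therefore consists of words one letter shorter. -/
theorem word_sub_word_mem_of_perm {X : I → End ℂ M}
    (hX : ∀ i j, X i * X j - X j * X i ∈ Submodule.span ℂ (Set.range X))
    {U : Submodule ℂ M} {u : M} (hu : u ∈ U) {p q : List I} (h : p.Perm q) :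
    word X p u - word X q u ∈ wordSpanLT X U p.length := by
  induction h with
  | nil => simp
  | cons i h ih =>
    rw [word_cons, word_cons, ← map_sub]
    exact apply_mem_wordSpanLT X U i ih
  | swap i j p =>
    have key : ∀ T ∈ Submodule.span ℂ (Set.range X),
        T (word X p u) ∈ wordSpanLT X U (p.length + 2) := by
      intro T hT
      induction hT using Submodule.span_induction with
      | mem T hT =>
        obtain ⟨r, rfl⟩ := hT
        exact Submodule.subset_span ⟨r :: p, by simp, u, hu, by simp⟩
      | zero => simp
      | add S T _ _ hS hT => exact Submodule.add_mem _ hS hT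
      | smul c T _ hT => exact Submodule.smul_mem _ c hT
    simpa using key _ (hX j i)
  | trans h₁ _ ih₁ ih₂ =>
    rw [← h₁.length_eq] at ih₂
    simpa using Submodule.add_mem _ ih₁ ih₂

end Word

/-! ### Ordered monomials, and their independence by differentiation. -/

section Monomial

variable {M A B : Type*} [AddCommGroup M] [Module ℂ M] [AddCommGroup A] [Module ℂ A]
  [AddCommGroup B] [Module ℂ B]

/-- The ordered monomial in the operators `X i` with the given multiset of indices. -/
def monomial (X : ℕ → End ℂ M) (l : Multiset ℕ) : End ℂ M := word X (l.sort (· ≤ ·))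

/-- The linear map sending a formal combination of ordered monomials with coefficients in `A`
to its value in `M`. -/
noncomputable def monomialMap (X : ℕ → End ℂ M) (e : A →ₗ[ℂ] M) : (Multiset ℕ →₀ A) →ₗ[ℂ] M :=
  Finsupp.lsum ℂ fun l => monomial X l ∘ₗ e

theorem monomialMap_apply (X : ℕ → End ℂ M) (e : A →ₗ[ℂ] M) (f : Multiset ℕ →₀ A) :
    monomialMap X e f = ∑ l ∈ f.support, monomial X l (e (f l)) := rfl

theorem monomialMap_single (X : ℕ → End ℂ M) (e : A →ₗ[ℂ] M) (l : Multiset ℕ) (a : A) :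
    monomialMap X e (Finsupp.single l a) = monomial X l (e a) := by
  simp [monomialMap]

theorem monomialMap_single_zero (X : ℕ → End ℂ M) (e : A →ₗ[ℂ] M) (a : A) :
    monomialMap X e (Finsupp.single 0 a) = e a := by
  simp [monomialMap_single, monomial]

theorem monomialMap_comp (X : ℕ → End ℂ M) (e : A →ₗ[ℂ] M) (g : B →ₗ[ℂ] A) :
    monomialMap X (e ∘ₗ g) = monomialMap X e ∘ₗ Finsupp.mapRange.linearMap g := by
  ext l b
  simp [monomialMap_single]

theorem comp_monomialMap {N : Type*} [AddCommGroup N] [Module ℂ N] {X : ℕ → End ℂ M}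
    {Y : ℕ → End ℂ N} (e : A →ₗ[ℂ] M) (φ : M →ₗ[ℂ] N) (h : ∀ i m, φ (X i m) = Y i (φ m)) :
    φ ∘ₗ monomialMap X e = monomialMap Y (φ ∘ₗ e) := by
  have hw : ∀ p m, φ (word X p m) = word Y p (φ m) := by
    intro p m
    induction p with
    | nil => simp
    | cons i p ih => simp [h, ih]
  ext l a
  simp [monomialMap_single, monomial, hw]

/-- Induction on the length of a word: sorting it changes it only by shorter words. This is the
spanning half of a Poincaré–Birkhoff–Witt statement. -/
theorem range_monomialMap {X : ℕ → End ℂ M}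
    (hX : ∀ i j, X i * X j - X j * X i ∈ Submodule.span ℂ (Set.range X)) (e : A →ₗ[ℂ] M) :
    LinearMap.range (monomialMap X e) = wordSpan X (LinearMap.range e) := by
  refine le_antisymm ?_ (Submodule.span_le.mpr ?_)
  · rintro _ ⟨f, rfl⟩
    exact Submodule.sum_mem _ fun l _ => Submodule.subset_span ⟨_, _, ⟨_, rfl⟩, rfl⟩
  · rintro _ ⟨p, _, ⟨a, rfl⟩, rfl⟩
    have key : ∀ n, ∀ p : List ℕ, p.length < n → ∀ a,
        word X p (e a) ∈ LinearMap.range (monomialMap X e) := by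
      intro n
      induction n with
      | zero => simp
      | succ n ih =>
        intro p hp a
        have hlt : wordSpanLT X (LinearMap.range e) p.length ≤
            LinearMap.range (monomialMap X e) := by
          refine Submodule.span_le.mpr ?_
          rintro _ ⟨q, hq, _, ⟨b, rfl⟩, rfl⟩
          exact ih q (by omega) b
        have hperm : p.Perm ((p : Multiset ℕ).sort (· ≤ ·)) := by
          rw [← Multiset.coe_eq_coe, Multiset.sort_eq]
        have h₁ := hlt (word_sub_word_mem_of_perm hX (LinearMap.mem_range_self e a) hperm)
        have h₂ : word X ((p : Multiset ℕ).sort (· ≤ ·)) (e a) ∈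
            LinearMap.range (monomialMap X e) :=
          ⟨Finsupp.single (p : Multiset ℕ) a, monomialMap_single X e _ a⟩
        simpa using Submodule.add_mem _ h₁ h₂
    exact key _ p (Nat.lt_succ_self _) a

/-- The degree of a word, the index `i` having degree `i + 2`. -/
def deg (p : List ℕ) : ℤ := (p.map fun i : ℕ => (i : ℤ) + 2).sum

@[simp] theorem deg_nil : deg [] = 0 := rfl

@[simp] theorem deg_cons (i : ℕ) (p : List ℕ) : deg (i :: p) = i + 2 + deg p := by
  simp [deg]

theorem deg_nonneg (p : List ℕ) : 0 ≤ deg p := by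
  induction p with
  | nil => simp
  | cons i p ih => rw [deg_cons]; omega

theorem deg_erase {i : ℕ} {p : List ℕ} (h : i ∈ p) : deg (p.erase i) = deg p - (i + 2) := by
  have : deg p = deg (i :: p.erase i) :=
    ((List.perm_cons_erase h).map fun i : ℕ => (i : ℤ) + 2).sum_eq
  rw [this, deg_cons]
  ring

/-- The span of the words of degree at most `N` applied to vectors of `U`. -/
def degLE (X : ℕ → End ℂ M) (U : Submodule ℂ M) (N : ℤ) : Submodule ℂ M :=
  Submodule.span ℂ {m | ∃ p, deg p ≤ N ∧ ∃ u ∈ U, word X p u = m}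

theorem word_mem_degLE (X : ℕ → End ℂ M) {U : Submodule ℂ M} {N : ℤ} {p : List ℕ}
    (hp : deg p ≤ N) {u : M} (hu : u ∈ U) : word X p u ∈ degLE X U N :=
  Submodule.subset_span ⟨p, hp, u, hu, rfl⟩

theorem degLE_mono (X : ℕ → End ℂ M) (U : Submodule ℂ M) {N N' : ℤ} (h : N ≤ N') :
    degLE X U N ≤ degLE X U N' :=
  Submodule.span_mono fun _ ⟨p, hp, hu⟩ => ⟨p, hp.trans h, hu⟩

theorem degLE_of_neg (X : ℕ → End ℂ M) (U : Submodule ℂ M) {N : ℤ} (h : N < 0) :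
    degLE X U N = ⊥ := by
  refine le_bot_iff.mp (Submodule.span_le.mpr ?_)
  rintro _ ⟨p, hp, _⟩
  exact absurd (deg_nonneg p) (by omega)

theorem apply_mem_degLE (X : ℕ → End ℂ M) (U : Submodule ℂ M) (i : ℕ) {N N' : ℤ} {m : M}
    (hm : m ∈ degLE X U N) (hN : N + i + 2 ≤ N') : X i m ∈ degLE X U N' := by
  have : degLE X U N ≤ (degLE X U N').comap (X i) := by
    refine Submodule.span_le.mpr ?_
    rintro _ ⟨p, hp, u, hu, rfl⟩
    exact Submodule.subset_span ⟨i :: p, by rw [deg_cons]; omega, u, hu, by simp⟩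
  exact this hm

/-- Up to terms of lower degree, the operators `D i` differentiate words in the `X i`, with
coefficients given by operators `T i` injective on `U`. -/
structure Differentiates (X D T : ℕ → End ℂ M) (U : Submodule ℂ M) : Prop where
  mem : ∀ i : ℕ, ∀ u ∈ U, T i u ∈ U
  inj : ∀ i : ℕ, ∀ u ∈ U, T i u = 0 → u = 0
  lower : ∀ (i : ℕ) (p : List ℕ), ∀ u ∈ U, D i (word X p u) ∈ degLE X U (deg p - (i + 2))
  leading : ∀ (i : ℕ) (p : List ℕ), p.Pairwise (· ≤ ·) → ∀ u ∈ U,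
    D i (word X p u) - p.count i • word X (p.erase i) (T i u) ∈
      degLE X U (deg p - (i + 2) - 1)

/-- The Leibniz rule: `D i` moves to the right through the word until it kills `u`, leaving one
commutator `R i b` per letter `b`. Only the letters `b = i` contribute in the leading degree, each
giving `T i`. -/
theorem Differentiates.of_commutator {X D T : ℕ → End ℂ M} {U : Submodule ℂ M}
    (R : ℕ → ℕ → End ℂ M) (mem : ∀ i, ∀ u ∈ U, T i u ∈ U)
    (inj : ∀ i, ∀ u ∈ U, T i u = 0 → u = 0) (hD : ∀ i, ∀ u ∈ U, D i u = 0)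
    (hR : ∀ i b m, D i (X b m) = X b (D i m) + R i b m)
    (hne : ∀ i b : ℕ, b ≠ i → ∀ p, ∀ u ∈ U, R i b (word X p u) ∈ degLE X U (deg p + b - i - 1))
    (heq : ∀ i p, ∀ u ∈ U, R i i (word X p u) - word X p (T i u) ∈ degLE X U (deg p - 1)) :
    Differentiates X D T U where
  mem := mem
  inj := inj
  lower i p u hu := by
    induction p with
    | nil => rw [word_nil, hD i u hu]; exact Submodule.zero_mem _
    | cons b p ih =>
      rw [word_cons, hR, deg_cons]
      refine Submodule.add_mem _ (apply_mem_degLE X U b ih (by omega)) ?_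
      by_cases hb : b = i
      · subst hb
        have h₁ := degLE_mono X U (N' := deg p) (by omega) (heq b p u hu)
        have h₂ := word_mem_degLE X (le_refl (deg p)) (mem b u hu)
        exact degLE_mono X U (by omega) ((Submodule.sub_mem_iff_left _ h₂).mp h₁)
      · exact degLE_mono X U (by omega) (hne i b hb p u hu)
  leading i p hp u hu := by
    induction p with
    | nil => simp [hD i u hu]
    | cons b p ih =>
      have ih := ih hp.of_cons
      rw [word_cons, hR, deg_cons]
      by_cases hb : b = i
      · subst hb
        -- Sortedness enters here: `b` is at most every letter of `p`, so if it occurs in `p` it is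
        -- the head, and putting `X b` back in front of `p.erase b` restores `p`. If it does not
        -- occur, the multiplicity is zero.
        have h₁ : X b (p.count b • word X (p.erase b) (T b u)) =
            p.count b • word X p (T b u) := by
          by_cases hbp : b ∈ p
          · cases p with
            | nil => simp at hbp
            | cons c p =>
              have hc : c = b := by
                refine le_antisymm ?_ ((List.pairwise_cons.mp hp).1 c (by simp))
                rcases List.mem_cons.mp hbp with rfl | h
                · exact le_rfl
                · exact (List.pairwise_cons.mp hp.of_cons).1 b h
              subst hc
              simp
          · simp [List.count_eq_zero_of_not_mem hbp]
        have h₂ := apply_mem_degLE X U b (N' := b + 2 + deg p - (b + 2) - 1) ih (by omega)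
        have h₃ := degLE_mono X U (N' := b + 2 + deg p - (b + 2) - 1) (by omega) (heq b p u hu)
        rw [map_sub, h₁] at h₂
        convert Submodule.add_mem _ h₂ h₃ using 1
        rw [List.count_cons_self, List.erase_cons_head]
        module
      · have h₁ : word X ((b :: p).erase i) (T i u) = X b (word X (p.erase i) (T i u)) := by
          rw [List.erase_cons_tail (by simpa using hb), word_cons]
        have h₂ := apply_mem_degLE X U b (N' := b + 2 + deg p - (i + 2) - 1) ih (by omega)
        have h₃ := degLE_mono X U (N' := b + 2 + deg p - (i + 2) - 1) (by omega)
          (hne i b hb p u hu)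
        convert Submodule.add_mem _ h₂ h₃ using 1
        rw [List.count_cons_of_ne hb, h₁, map_sub, map_nsmul]
        abel

theorem Differentiates.apply_mem_degLE {X D T : ℕ → End ℂ M} {U : Submodule ℂ M}
    (h : Differentiates X D T U) (i : ℕ) {N N' : ℤ} {m : M} (hm : m ∈ degLE X U N)
    (hN : N - (i + 2) ≤ N') : D i m ∈ degLE X U N' := by
  have : degLE X U N ≤ (degLE X U N').comap (D i) := by
    refine Submodule.span_le.mpr ?_
    rintro _ ⟨p, hp, u, hu, rfl⟩
    change D i (word X p u) ∈ degLE X U N'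
    exact degLE_mono X U (by omega) (h.lower i p u hu)
  exact this hm

theorem sort_erase (l : Multiset ℕ) (i : ℕ) :
    (l.erase i).sort (· ≤ ·) = (l.sort (· ≤ ·)).erase i := by
  refine List.Perm.eq_of_pairwise' (r := (· ≤ ·)) (Multiset.pairwise_sort _ _)
    ((Multiset.pairwise_sort l (· ≤ ·)).sublist List.erase_sublist) ?_
  rw [← Multiset.coe_eq_coe, Multiset.sort_eq, ← Multiset.coe_erase, Multiset.sort_eq]

/-- A homogeneous relation modulo lower degree is differentiated by a letter `i` of one of its
monomials. This gives a relation of degree `N - (i + 2)`, whose coefficients vanish by induction;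
the multiplicity is invertible in `ℂ` and `T i` is injective on `U`, so the original coefficient
vanishes too. -/
theorem Differentiates.eq_zero_of_sum_mem {X D T : ℕ → End ℂ M} {U : Submodule ℂ M}
    (h : Differentiates X D T U) (N : ℕ) : ∀ (s : Finset (Multiset ℕ)) (f : Multiset ℕ → M),
      (∀ l ∈ s, deg (l.sort (· ≤ ·)) = N) → (∀ l, f l ∈ U) →
      ∑ l ∈ s, monomial X l (f l) ∈ degLE X U (N - 1) → ∀ l ∈ s, f l = 0 := by
  induction N using Nat.strong_induction_on with
  | _ N ih =>
  intro s f hs hf hsum l hl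
  rcases Multiset.empty_or_exists_mem l with rfl | ⟨i, hi⟩
  · have hN : (N : ℤ) = 0 := by rw [← hs 0 hl]; simp
    have hs0 : s = {0} := by
      refine Finset.eq_singleton_iff_unique_mem.mpr ⟨hl, fun l' hl' => ?_⟩
      rcases Multiset.empty_or_exists_mem l' with rfl | ⟨i, hi⟩
      · rfl
      · have h₁ := hs l' hl'
        have h₂ := deg_erase ((Multiset.mem_sort (· ≤ ·)).mpr hi)
        have h₃ := deg_nonneg ((l'.sort (· ≤ ·)).erase i)
        omega
    rw [degLE_of_neg X U (by omega), hs0] at hsum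
    simpa [monomial] using hsum
  · have hmem : ∀ {l : Multiset ℕ} {i : ℕ}, i ∈ l → i ∈ l.sort (· ≤ ·) :=
      fun hi => (Multiset.mem_sort (· ≤ ·)).mpr hi
    have hle : (i : ℤ) + 2 ≤ N := by
      have h₁ := hs l hl
      have h₂ := deg_erase (hmem hi)
      have h₃ := deg_nonneg ((l.sort (· ≤ ·)).erase i)
      omega
    obtain ⟨N', hN'⟩ : ∃ N' : ℕ, (N' : ℤ) = N - (i + 2) := ⟨N - (i + 2), by omega⟩
    -- Erasing `i` is injective only on multisets that contain `i`; the others have multiplicity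
    -- zero and drop out of the derivative.
    set s' := (s.filter (i ∈ ·)).image (Multiset.erase · i) with hs'
    set f' : Multiset ℕ → M := fun l => (i ::ₘ l).count i • T i (f (i ::ₘ l)) with hf'
    have hcount : ∀ l : Multiset ℕ, (l.sort (· ≤ ·)).count i = l.count i := by
      intro l
      rw [← Multiset.coe_count, Multiset.sort_eq]
    have hsum' : ∑ l ∈ s', monomial X l (f' l) ∈ degLE X U (N' - 1) := by
      have h₁ : D i (∑ l ∈ s, monomial X l (f l)) ∈ degLE X U (N' - 1) :=
        h.apply_mem_degLE i hsum (by omega)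
      have h₂ : ∑ l ∈ s, (D i (monomial X l (f l)) -
          l.count i • monomial X (l.erase i) (T i (f l))) ∈ degLE X U (N' - 1) := by
        refine Submodule.sum_mem _ fun l hl => ?_
        have := h.leading i (l.sort (· ≤ ·)) (Multiset.pairwise_sort _ _) (f l) (hf l)
        rw [hs l hl, hcount, ← sort_erase] at this
        exact degLE_mono X U (by omega) this
      have h₃ : ∑ l ∈ s', monomial X l (f' l) =
          ∑ l ∈ s, l.count i • monomial X (l.erase i) (T i (f l)) := by
        rw [hs', Finset.sum_image, Finset.sum_filter]
        · refine Finset.sum_congr rfl fun l _ => ?_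
          split_ifs with hi
          · simp only [hf', Multiset.cons_erase hi, map_nsmul]
          · rw [Multiset.count_eq_zero_of_notMem hi, zero_smul]
        · intro l₁ h₁ l₂ h₂ h₁₂
          simp only [Finset.coe_filter, Set.mem_ofPred_eq] at h₁ h₂ h₁₂
          rw [← Multiset.cons_erase h₁.2, ← Multiset.cons_erase h₂.2, h₁₂]
      rw [Finset.sum_sub_distrib, ← map_sum] at h₂
      rw [h₃]
      simpa using Submodule.sub_mem _ h₁ h₂
    have h0 := ih N' (by omega) s' f' ?_ ?_ hsum' (l.erase i)
      (Finset.mem_image_of_mem _ (Finset.mem_filter.mpr ⟨hl, hi⟩))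
    · simp only [hf', Multiset.cons_erase hi] at h0
      rw [← Nat.cast_smul_eq_nsmul ℂ, smul_eq_zero] at h0
      refine h.inj i _ (hf l) (h0.resolve_left ?_)
      exact_mod_cast (Multiset.count_pos.mpr hi).ne'
    · intro l' hl'
      obtain ⟨l₁, hl₁, rfl⟩ := Finset.mem_image.mp hl'
      rw [Finset.mem_filter] at hl₁
      rw [sort_erase, deg_erase (hmem hl₁.2), hs l₁ hl₁.1, hN']
    · exact fun l => Submodule.smul_of_tower_mem _ _ (h.mem i _ (hf _))

/-- In a nontrivial relation, the part of top degree equals minus the rest, hence lies in lower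
degree. -/
theorem Differentiates.injective_monomialMap {X D T : ℕ → End ℂ M} {U : Submodule ℂ M}
    (h : Differentiates X D T U) {e : A →ₗ[ℂ] M} (he : Function.Injective e)
    (heU : ∀ a, e a ∈ U) : Function.Injective (monomialMap X e) := by
  rw [injective_iff_map_eq_zero]
  intro f hf
  by_contra hne
  obtain ⟨l₀, hl₀, hmax⟩ := f.support.exists_max_image (fun l => deg (l.sort (· ≤ ·)))
    (Finsupp.support_nonempty_iff.mpr hne)
  obtain ⟨N, hN⟩ := Int.eq_ofNat_of_zero_le (deg_nonneg (l₀.sort (· ≤ ·)))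
  have hz := h.eq_zero_of_sum_mem N (f.support.filter fun l => deg (l.sort (· ≤ ·)) = N)
    (fun l => e (f l)) (fun l hl => (Finset.mem_filter.mp hl).2) (fun l => heU _) ?_ l₀
    (Finset.mem_filter.mpr ⟨hl₀, hN⟩)
  · exact Finsupp.mem_support_iff.mp hl₀ (he (by rw [hz, map_zero]))
  · rw [monomialMap_apply, ← Finset.sum_filter_add_sum_filter_not _
      (fun l => deg (l.sort (· ≤ ·)) = N)] at hf
    rw [eq_neg_of_add_eq_zero_left hf]
    refine Submodule.neg_mem _ (Submodule.sum_mem _ fun l hl => ?_)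
    rw [Finset.mem_filter] at hl
    have := hmax l hl.1
    exact word_mem_degLE X (by omega) (heU _)

end Monomial

end OrderedMonomials

namespace OrderedMonomials

/-! ### Schur's lemma in countable dimension. -/

section Schur

variable {L M : Type*} [LieRing L] [LieAlgebra ℂ L] [AddCommGroup M] [Module ℂ M]
  [LieRingModule L M] [LieModule ℂ L M]

/-- An irreducible module over a Lie algebra of countable dimension has countable dimension. -/
theorem exists_countable_span_eq_top [LieModule.IsIrreducible ℂ L M] {ι : Type*} [Countable ι]
    (b : ι → L) (hb : Submodule.span ℂ (Set.range b) = ⊤) :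
    ∃ s : Set M, s.Countable ∧ Submodule.span ℂ s = ⊤ := by
  have : Nontrivial M := (LieSubmodule.nontrivial_iff ℂ L M).mp inferInstance
  obtain ⟨v, hv⟩ := exists_ne (0 : M)
  let X : ι → End ℂ M := fun i => LieModule.toEnd ℂ L M (b i)
  let N : LieSubmodule ℂ L M :=
    { Submodule.span ℂ (Set.range fun p : List ι => word X p v) with
      lie_mem := by
        intro x m hm
        change ⁅x, m⁆ ∈ Submodule.span ℂ (Set.range fun p : List ι => word X p v)
        change m ∈ Submodule.span ℂ (Set.range fun p : List ι => word X p v) at hm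
        have hx : x ∈ Submodule.span ℂ (Set.range b) := hb ▸ Submodule.mem_top
        induction hx, hm using Submodule.span_induction₂ with
        | mem_mem x m hx hm =>
          obtain ⟨i, rfl⟩ := hx
          obtain ⟨p, rfl⟩ := hm
          exact Submodule.subset_span ⟨i :: p, by simp [X]⟩
        | zero_left y _ => simp
        | zero_right x _ => simp
        | add_left x y z _ _ _ h₁ h₂ => rw [add_lie]; exact Submodule.add_mem _ h₁ h₂
        | add_right x y z _ _ _ h₁ h₂ => rw [lie_add]; exact Submodule.add_mem _ h₁ h₂
        | smul_left c x y _ _ h => rw [smul_lie]; exact Submodule.smul_mem _ c h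
        | smul_right c x y _ _ h => rw [lie_smul]; exact Submodule.smul_mem _ c h }
  have hN : N = ⊤ := by
    refine (eq_bot_or_eq_top N).resolve_left fun h => hv ?_
    have : v ∈ N := Submodule.subset_span ⟨[], rfl⟩
    rwa [h, LieSubmodule.mem_bot] at this
  refine ⟨_, Set.countable_range fun p : List ι => word X p v, ?_⟩
  exact (LieSubmodule.toSubmodule_eq_top N).mpr hN

/-- Over `ℂ` the polynomial splits, so its value at `T` is a nonzero scalar times a product of the
injective operators `T - c`. -/
theorem injective_aeval_of_forall_injective {T : End ℂ M}
    (hT : ∀ c : ℂ, Function.Injective (T - algebraMap ℂ (End ℂ M) c)) {q : Polynomial ℂ}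
    (hq : q ≠ 0) : Function.Injective (Polynomial.aeval T q) := by
  have hs := (IsAlgClosed.splits q).eq_prod_roots
  have key : ∀ s : Multiset ℂ, Function.Injective
      (Polynomial.aeval T ((s.map fun a => Polynomial.X - Polynomial.C a).prod)) := by
    intro s
    induction s using Multiset.induction with
    | empty =>
      rw [Multiset.map_zero, Multiset.prod_zero, map_one]
      exact Function.injective_id
    | cons a s ih =>
      rw [Multiset.map_cons, Multiset.prod_cons, map_mul, map_sub,
        Polynomial.aeval_X, Polynomial.aeval_C]
      exact (hT a).comp ih
  rw [hs, map_mul, Polynomial.aeval_C]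
  have hc : Function.Injective (algebraMap ℂ (End ℂ M) q.leadingCoeff) := by
    intro v w h
    simpa [Module.algebraMap_end_apply, hq] using h
  exact hc.comp (key _)

/-- Schur's lemma for an irreducible module over a complex Lie algebra of countable dimension. -/
theorem exists_eq_smul_of_isIrreducible [LieModule.IsIrreducible ℂ L M] {ι : Type*} [Countable ι]
    (b : ι → L) (hb : Submodule.span ℂ (Set.range b) = ⊤) (T : M →ₗ⁅ℂ, L⁆ M) :
    ∃ c : ℂ, ∀ m, T m = c • m := by
  -- If `T` is not a scalar, every `T - c` is bijective. The vectors `(T - c)⁻¹ v`, for `c` in `ℂ`,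
  -- are then independent, and there are too many of them.
  by_contra! hne
  have : Nontrivial M := (LieSubmodule.nontrivial_iff ℂ L M).mp inferInstance
  let S : ℂ → (M →ₗ⁅ℂ, L⁆ M) := fun c => T - c • LieModuleHom.id
  have hS : ∀ c m, S c m = T m - c • m := fun c m => by simp [S]
  have hinj : ∀ c, Function.Injective (S c) := by
    intro c
    rw [← LieModuleHom.ker_eq_bot]
    by_contra h
    obtain ⟨m, hm⟩ := hne c
    have : m ∈ (S c).ker := by
      rw [(eq_bot_or_eq_top _).resolve_left h]; trivial
    rw [LieModuleHom.mem_ker, hS, sub_eq_zero] at this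
    exact hm this
  have hsurj : ∀ c, Function.Surjective (S c) := by
    intro c
    rw [← LieModuleHom.range_eq_top]
    refine (eq_bot_or_eq_top _).resolve_left fun h => ?_
    obtain ⟨m, hm⟩ := exists_ne (0 : M)
    have : S c m ∈ (S c).range := ⟨m, rfl⟩
    rw [h, LieSubmodule.mem_bot] at this
    exact hm (hinj c (by rw [this, map_zero]))
  obtain ⟨v, hv⟩ := exists_ne (0 : M)
  choose w hw using fun c => hsurj c v
  let T' : End ℂ M := T
  have hT' : ∀ c m, (T' - algebraMap ℂ (End ℂ M) c) m = S c m := fun c m => by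
    simp [hS, T', Module.algebraMap_end_apply]
  have hlin : LinearIndependent ℂ w := by
    rw [linearIndependent_iff']
    intro s a hsum c hc
    by_contra hac
    -- Clearing denominators in a relation among the `(T - j)⁻¹ v`, by applying the product of all
    -- `T - j`, turns it into `q(T) v = 0`. Evaluating `q` at `c` isolates the coefficient `a c`, so
    -- `q ≠ 0`.
    let q : Polynomial ℂ := ∑ i ∈ s, Polynomial.C (a i) *
      ∏ j ∈ s.erase i, (Polynomial.X - Polynomial.C j)
    have hq : q ≠ 0 := by
      intro h0
      have h1 : q.eval c = a c * ∏ j ∈ s.erase c, (c - j) := by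
        simp only [q, Polynomial.eval_finsetSum, Polynomial.eval_mul, Polynomial.eval_C,
          Polynomial.eval_prod, Polynomial.eval_sub, Polynomial.eval_X]
        refine Finset.sum_eq_single_of_mem c hc fun i _ hi => ?_
        rw [Finset.prod_eq_zero (i := c) (Finset.mem_erase.mpr ⟨hi.symm, hc⟩) (sub_self c),
          mul_zero]
      rw [h0, Polynomial.eval_zero, eq_comm, mul_eq_zero] at h1
      refine h1.elim hac fun h => ?_
      obtain ⟨j, hj, hj'⟩ := Finset.prod_eq_zero_iff.mp h
      exact (Finset.mem_erase.mp hj).1 (sub_eq_zero.mp hj').symm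
    have hqv : Polynomial.aeval T' q v = 0 := by
      have h1 : ∀ i ∈ s, Polynomial.aeval T' (Polynomial.C (a i) *
          ∏ j ∈ s.erase i, (Polynomial.X - Polynomial.C j)) v =
          Polynomial.aeval T' (∏ j ∈ s, (Polynomial.X - Polynomial.C j)) (a i • w i) := by
        intro i hi
        rw [← Finset.prod_erase_mul s _ hi, map_mul, map_mul, Polynomial.aeval_C,
          Module.End.mul_apply, Module.End.mul_apply, map_sub, Polynomial.aeval_X,
          Polynomial.aeval_C, hT', map_smul, hw, map_smul, Module.algebraMap_end_apply]
      simp only [q, map_sum, LinearMap.sum_apply]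
      rw [Finset.sum_congr rfl h1, ← map_sum, hsum, map_zero]
    refine hv (injective_aeval_of_forall_injective (T := T') (fun c => ?_) hq (by simpa using hqv))
    convert hinj c using 1
    exact funext (hT' c)
  obtain ⟨s, hs, hspan⟩ := exists_countable_span_eq_top (M := M) b hb
  have h1 := hlin.cardinal_lift_le_rank
  have h2 : Module.rank ℂ M ≤ Cardinal.aleph0 := by
    rw [← rank_top, ← hspan]
    exact (rank_span_le s).trans hs.le_aleph0
  have h3 := h1.trans (Cardinal.lift_le.mpr h2)
  rw [Cardinal.mk_complex, Cardinal.lift_continuum, Cardinal.lift_aleph0] at h3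
  exact absurd h3 (not_le.mpr Cardinal.aleph0_lt_continuum)

end Schur

end OrderedMonomials

/-! ### Commutation relations on a module, and the three families of lowering operators. -/

namespace EHV

open OrderedMonomials

variable {α β : ℂ} {M : Type*} [AddCommGroup M] [Module ℂ M] [LieRingModule (Alg α β 0) M]
  [LieModule ℂ (Alg α β 0) M]

/-- The action of a basis element on a module. -/
noncomputable def act (α β : ℂ) (M : Type*) [AddCommGroup M] [Module ℂ M]
    [LieRingModule (Alg α β 0) M] [LieModule ℂ (Alg α β 0) M] (g : Gen) : End ℂ M :=
  LieModule.toEnd ℂ (Alg α β 0) M (gen α β 0 g)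

theorem act_apply (g : Gen) (m : M) : act α β M g m = ⁅gen α β 0 g, m⁆ := rfl

theorem act_act (g h : Gen) (m : M) :
    act α β M g (act α β M h m) = ⁅genBracket α β 0 g h, m⁆ + act α β M h (act α β M g m) := by
  simp only [act_apply]
  rw [leibniz_lie, lie_def, bracket_gen]

theorem act_G_L (m n : ℤ) (v : M) : act α β M (.G m) (act α β M (.L n) v) =
    (α + m + n * β) • act α β M (.G (m + n)) v + act α β M (.L n) (act α β M (.G m) v) := by
  rw [act_act, genBracket, smul_lie]
  rfl

theorem act_L_G (m n : ℤ) (v : M) : act α β M (.L m) (act α β M (.G n) v) =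
    (-(α + n + m * β)) • act α β M (.G (m + n)) v + act α β M (.G n) (act α β M (.L m) v) := by
  rw [act_act, genBracket, smul_lie]
  rfl

theorem act_G_G (m n : ℤ) (v : M) : act α β M (.G m) (act α β M (.G n) v) =
    act α β M (.G n) (act α β M (.G m) v) := by
  rw [act_act, genBracket, zero_lie, zero_add] <;> simp

theorem act_J_G (m n : ℤ) (v : M) : act α β M (.J m) (act α β M (.G n) v) =
    act α β M (.G n) (act α β M (.J m) v) := by
  rw [act_act, genBracket, zero_smul, zero_lie, zero_add]

theorem act_J_J (m n : ℤ) (v : M) : act α β M (.J m) (act α β M (.J n) v) =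
    ((m : ℂ) * delta (m + n)) • act α β M .C₃ v + act α β M (.J n) (act α β M (.J m) v) := by
  rw [act_act, genBracket, smul_lie]
  rfl

theorem act_L_L (m n : ℤ) (v : M) : act α β M (.L m) (act α β M (.L n) v) =
    ((m : ℂ) - n) • act α β M (.L (m + n)) v +
      (((m : ℂ) ^ 3 - m) / 12 * delta (m + n)) • act α β M .C₁ v +
      act α β M (.L n) (act α β M (.L m) v) := by
  rw [act_act, genBracket, add_lie, smul_lie, smul_lie]
  rfl

theorem act_L_J (m n : ℤ) (v : M) : act α β M (.L m) (act α β M (.J n) v) =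
    (-(n : ℂ)) • act α β M (.J (m + n)) v -
      (((m : ℂ) ^ 2 + m) * delta (m + n)) • act α β M .C₂ v +
      act α β M (.J n) (act α β M (.L m) v) := by
  rw [act_act, genBracket, sub_lie, smul_lie, smul_lie]
  rfl

/-- The vectors killed by `g m` for all `m > n`, where `g` is one of the families of basis
elements. -/
def killed (α β : ℂ) (M : Type*) [AddCommGroup M] [Module ℂ M] [LieRingModule (Alg α β 0) M]
    [LieModule ℂ (Alg α β 0) M] (g : ℤ → Gen) (n : ℤ) : Submodule ℂ M where
  carrier := {v | ∀ m, n < m → act α β M (g m) v = 0}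
  add_mem' hv hw m hm := by rw [map_add, hv m hm, hw m hm, add_zero]
  zero_mem' m _ := map_zero _
  smul_mem' c v hv m hm := by rw [map_smul, hv m hm, smul_zero]

theorem mem_killed {g : ℤ → Gen} {n : ℤ} {v : M} :
    v ∈ killed α β M g n ↔ ∀ m, n < m → act α β M (g m) v = 0 := Iff.rfl

/-- The operators `L_{-1}, L_{-2}, …`. -/
noncomputable def lowL (α β : ℂ) (M : Type*) [AddCommGroup M] [Module ℂ M]
    [LieRingModule (Alg α β 0) M] [LieModule ℂ (Alg α β 0) M] (i : ℕ) : End ℂ M :=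
  act α β M (.L (-(i + 1)))

/-- The operators `J_{-d-1}, J_{-d-2}, …`. -/
noncomputable def lowJ (α β : ℂ) (M : Type*) [AddCommGroup M] [Module ℂ M]
    [LieRingModule (Alg α β 0) M] [LieModule ℂ (Alg α β 0) M] (d i : ℕ) : End ℂ M :=
  act α β M (.J (-d - (i + 1)))

/-- The operators `G_{-d-1}, G_{-d-2}, …`. -/
noncomputable def lowG (α β : ℂ) (M : Type*) [AddCommGroup M] [Module ℂ M]
    [LieRingModule (Alg α β 0) M] [LieModule ℂ (Alg α β 0) M] (d i : ℕ) : End ℂ M :=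
  act α β M (.G (-d - (i + 1)))

/-! ### The partners that differentiate `lowL`, `lowJ` and `lowG`. -/

section Independence

theorem act_G_mem_killed_G {k : ℤ} (m : ℤ) {v : M} (hv : v ∈ killed α β M .G k) :
    act α β M (.G m) v ∈ killed α β M .G k := fun n hn => by
  rw [act_G_G, hv n hn, map_zero]

theorem act_J_mem_killed_G {k : ℤ} (m : ℤ) {v : M} (hv : v ∈ killed α β M .G k) :
    act α β M (.J m) v ∈ killed α β M .G k := fun n hn => by
  rw [← act_J_G, hv n hn, map_zero]

theorem act_G_mem_killed_J {d : ℤ} (m : ℤ) {v : M} (hv : v ∈ killed α β M .J d) :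
    act α β M (.G m) v ∈ killed α β M .J d := fun n hn => by
  rw [act_J_G, hv n hn, map_zero]

/-- Each commutator with a letter of the word absorbs that letter into the index of `G`, which only
decreases and so stays at most `k`; the degree drops. -/
theorem act_G_word_lowL_sub_mem {k : ℤ} (p : List ℕ) : ∀ m ≤ k, ∀ u ∈ killed α β M .G k,
    act α β M (.G m) (word (lowL α β M) p u) - word (lowL α β M) p (act α β M (.G m) u) ∈
      degLE (lowL α β M) (killed α β M .G k) (deg p - 1) := by
  induction p with
  | nil => simp
  | cons b p ih =>
    intro m hm u hu
    rw [word_cons, word_cons]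
    have h₁ := ih (m + -(b + 1)) (by omega) u hu
    have h₂ := word_mem_degLE (lowL α β M) (le_refl (deg p))
      (act_G_mem_killed_G (m + -(b + 1)) hu)
    have h₃ := (Submodule.sub_mem_iff_left _ h₂).mp (degLE_mono _ _ (by omega) h₁)
    have h₄ := apply_mem_degLE (lowL α β M) _ b (N' := b + 2 + deg p - 1) (ih m hm u hu)
      (by omega)
    rw [map_sub] at h₄
    nth_rewrite 1 [lowL]
    rw [act_G_L, add_sub_assoc, deg_cons]
    exact Submodule.add_mem _ (Submodule.smul_mem _ _ (degLE_mono _ _ (by omega) h₃)) h₄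

theorem act_G_word_lowL_mem {k : ℤ} (p : List ℕ) {m : ℤ} (hm : m ≤ k) {u : M}
    (hu : u ∈ killed α β M .G k) : act α β M (.G m) (word (lowL α β M) p u) ∈
      degLE (lowL α β M) (killed α β M .G k) (deg p) :=
  (Submodule.sub_mem_iff_left _ (word_mem_degLE (lowL α β M) (le_refl (deg p))
    (act_G_mem_killed_G m hu))).mp
      (degLE_mono _ _ (by omega) (act_G_word_lowL_sub_mem p m hm u hu))

/-- Since `G_m` with `m > k` kills the vectors below, it survives only by absorbing letters
`L_{-i-1}` that lower its index by at least `m - k` in all. The degree `i + 2` of a letter exceeds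
its shift `i + 1` by one, so at least `m - k + 1` is lost. This extra unit is what makes the terms
`b < i` in `differentiates_lowL` of strictly lower degree. -/
theorem act_G_word_lowL_mem_of_lt {k : ℤ} (p : List ℕ) : ∀ m, k < m → ∀ u ∈ killed α β M .G k,
    act α β M (.G m) (word (lowL α β M) p u) ∈
      degLE (lowL α β M) (killed α β M .G k) (deg p - (m - k) - 1) := by
  induction p with
  | nil =>
    intro m hm u hu
    rw [word_nil, hu m hm]
    exact Submodule.zero_mem _
  | cons b p ih =>
    intro m hm u hu
    rw [word_cons, deg_cons]
    have h₁ := apply_mem_degLE (lowL α β M) _ b (N' := b + 2 + deg p - (m - k) - 1)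
      (ih m hm u hu) (by omega)
    nth_rewrite 1 [lowL]
    rw [act_G_L]
    refine Submodule.add_mem _ (Submodule.smul_mem _ _ ?_) h₁
    by_cases h : m + -(b + 1) ≤ k
    · exact degLE_mono _ _ (by omega) (act_G_word_lowL_mem p h hu)
    · exact degLE_mono _ _ (by omega) (ih (m + -(b + 1)) (by omega) u hu)

/-- The commutator of `G_{k+i+1}` with `L_{-i-1}` is a multiple of `G_k`. Its coefficient is nonzero
by `hαβ`, both `k + i + 1` and `-(i + 1)` being nonzero. -/
theorem differentiates_lowL (hαβ : ∀ n m : ℤ, n ≠ 0 → m ≠ 0 → α + n + m * β ≠ 0) {k : ℕ}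
    (hk : ∀ v ∈ killed α β M .G k, act α β M (.G k) v = 0 → v = 0) :
    Differentiates (lowL α β M) (fun i => act α β M (.G (k + i + 1)))
      (fun i => (α + ((k + i + 1 : ℤ) : ℂ) + ((-(i + 1) : ℤ) : ℂ) * β) • act α β M (.G k))
      (killed α β M .G k) := by
  refine .of_commutator (fun i b => (α + ((k + i + 1 : ℤ) : ℂ) + ((-(b + 1) : ℤ) : ℂ) * β) •
    act α β M (.G (k + i + 1 + -(b + 1)))) ?_ ?_ ?_ ?_ ?_ ?_
  · exact fun i u hu => Submodule.smul_mem _ _ (act_G_mem_killed_G _ hu)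
  · intro i u hu h
    rw [LinearMap.smul_apply, smul_eq_zero] at h
    exact hk u hu (h.resolve_left (hαβ _ _ (by omega) (by omega)))
  · exact fun i u hu => hu _ (by omega)
  · intro i b m
    rw [lowL, act_G_L, add_comm]
    rfl
  · intro i b hb p u hu
    refine Submodule.smul_mem _ _ ?_
    by_cases h : i < b
    · exact degLE_mono _ _ (by omega) (act_G_word_lowL_mem p (by omega) hu)
    · exact degLE_mono _ _ (by omega) (act_G_word_lowL_mem_of_lt p _ (by omega) u hu)
  · intro i p u hu
    rw [show (k : ℤ) + i + 1 + -(i + 1) = k by ring, LinearMap.smul_apply, LinearMap.smul_apply,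
      map_smul, ← smul_sub]
    exact Submodule.smul_mem _ _ (act_G_word_lowL_sub_mem p _ le_rfl u hu)

/-- Heisenberg relations: `J_{d+i+1}` commutes with every letter except `J_{-d-i-1}`, where the
commutator is the nonzero scalar `(d + i + 1) ℓ`. -/
theorem differentiates_lowJ {ℓ : ℂ} (hℓ : ℓ ≠ 0) (hC : ∀ v : M, act α β M .C₃ v = ℓ • v) (d : ℕ) :
    Differentiates (lowJ α β M d) (fun i => act α β M (.J (d + i + 1)))
      (fun i => (((d + i + 1 : ℤ) : ℂ) * ℓ) • LinearMap.id) (killed α β M .J d) := by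
  refine .of_commutator
    (fun i b => (((d + i + 1 : ℤ) : ℂ) * delta (d + i + 1 + (-d - (b + 1))) * ℓ) • LinearMap.id)
    ?_ ?_ ?_ ?_ ?_ ?_
  · exact fun i u hu => Submodule.smul_mem _ _ hu
  · intro i u hu h
    refine (smul_eq_zero.mp h).resolve_left (mul_ne_zero ?_ hℓ)
    rw [Int.cast_ne_zero]
    omega
  · exact fun i u hu => hu _ (by omega)
  · intro i b m
    rw [lowJ, act_J_J, hC, smul_smul, add_comm]
    rfl
  · intro i b hb p u hu
    rw [delta, if_neg (by omega), mul_zero, zero_mul, zero_smul]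
    exact Submodule.zero_mem _
  · intro i p u hu
    rw [delta, if_pos (by omega), mul_one]
    simp

theorem act_G_word_lowG (d : ℕ) (m : ℤ) (p : List ℕ) (u : M) :
    act α β M (.G m) (word (lowG α β M d) p u) = word (lowG α β M d) p (act α β M (.G m) u) := by
  induction p with
  | nil => rfl
  | cons b p ih => rw [word_cons, word_cons, ← ih, lowG, act_G_G]

theorem act_G_mem_killed_L {k d m : ℤ} (hm : -d ≤ m) {v : M}
    (hv : v ∈ killed α β M .G k ⊓ killed α β M .L (k + d)) :
    act α β M (.G m) v ∈ killed α β M .G k ⊓ killed α β M .L (k + d) := by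
  refine ⟨act_G_mem_killed_G m hv.1, fun n hn => ?_⟩
  rw [act_L_G, hv.2 n hn, map_zero, hv.1 _ (by omega), smul_zero, add_zero]

/-- The roles of `L` and `G` are exchanged: `L_{k+d+i+1}` and `G_{-d-i-1}` have as commutator a
multiple of `G_k`, again nonzero by `hαβ`. -/
theorem differentiates_lowG (hαβ : ∀ n m : ℤ, n ≠ 0 → m ≠ 0 → α + n + m * β ≠ 0) {k d : ℕ}
    (hd : 2 ≤ d) (hk : ∀ v ∈ killed α β M .G k, act α β M (.G k) v = 0 → v = 0) :
    Differentiates (lowG α β M d) (fun i => act α β M (.L (k + d + i + 1)))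
      (fun i => (-(α + ((-d - (i + 1) : ℤ) : ℂ) + ((k + d + i + 1 : ℤ) : ℂ) * β)) •
        act α β M (.G k))
      (killed α β M .G k ⊓ killed α β M .L (k + d)) := by
  refine .of_commutator (fun i b => (-(α + ((-d - (b + 1) : ℤ) : ℂ) +
    ((k + d + i + 1 : ℤ) : ℂ) * β)) • act α β M (.G (k + d + i + 1 + (-d - (b + 1)))))
    ?_ ?_ ?_ ?_ ?_ ?_
  · exact fun i u hu => Submodule.smul_mem _ _ (act_G_mem_killed_L (by omega) hu)
  · intro i u hu h
    rw [LinearMap.smul_apply, smul_eq_zero, neg_eq_zero] at h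
    exact hk u hu.1 (h.resolve_left (hαβ _ _ (by omega) (by omega)))
  · exact fun i u hu => hu.2 _ (by omega)
  · intro i b m
    rw [lowG, act_L_G, add_comm]
    rfl
  · intro i b hb p u hu
    refine Submodule.smul_mem _ _ ?_
    by_cases h : i < b
    · by_cases h' : -(d : ℤ) ≤ k + d + i + 1 + (-d - (b + 1))
      · rw [act_G_word_lowG]
        exact word_mem_degLE _ (by omega) (act_G_mem_killed_L h' hu)
      -- The commutator is here another letter, `G_{-d-t-1}`. Its degree `t + 2 = b - i - d - k + 1`
      -- must be at most `b - i - 1`, which is where `2 ≤ d` is used.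
      · obtain ⟨t, ht⟩ : ∃ t : ℕ, (t : ℤ) + 1 = b - i - d - k :=
          ⟨(b - i - d - k - 1 : ℤ).toNat, by omega⟩
        rw [show (k : ℤ) + d + i + 1 + (-d - (b + 1)) = -d - (t + 1) by omega]
        exact apply_mem_degLE (lowG α β M d) _ t (word_mem_degLE _ (le_refl (deg p)) hu)
          (by omega)
    · rw [act_G_word_lowG, hu.1 _ (by omega), map_zero]
      exact Submodule.zero_mem _
  · intro i p u hu
    rw [show (k : ℤ) + d + i + 1 + (-d - (i + 1)) = k by ring, LinearMap.smul_apply,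
      LinearMap.smul_apply, map_smul, ← smul_sub, act_G_word_lowG, sub_self, smul_zero]
    exact Submodule.zero_mem _

end Independence

/-! ### Stability of the span of monomials, by adjoining `G`, then `J`, then `L`. -/

section Spanning

/-- The vectors of the span that all `g` with `P g` send back into it are stable under each `x i`:
moving `g` past `x i` leaves a bracket that is again in the span of `P`. -/
theorem act_mem_wordSpan {P : Gen → Prop} (x : ℕ → Gen) {W : Submodule ℂ M}
    (hW : ∀ g, P g → ∀ w ∈ W, act α β M g w ∈ wordSpan (fun i => act α β M (x i)) W)
    (hx : ∀ g, P g → ∀ i, genBracket α β 0 g (x i) ∈ Submodule.span ℂ (gen α β 0 '' {g | P g}))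
    {g : Gen} (hg : P g) {w : M} (hw : w ∈ wordSpan (fun i => act α β M (x i)) W) :
    act α β M g w ∈ wordSpan (fun i => act α β M (x i)) W := by
  set K := wordSpan (fun i => act α β M (x i)) W with hK
  let N : Submodule ℂ M := K ⊓ ⨅ g : {g // P g}, K.comap (act α β M g)
  have hN : ∀ {m}, m ∈ N ↔ m ∈ K ∧ ∀ g, P g → act α β M g m ∈ K := by
    intro m
    simp [N, Submodule.mem_iInf]
  have hle : K ≤ N := by
    refine wordSpan_le (fun m hm => hN.mpr ⟨le_wordSpan _ _ hm, fun g hg => hW g hg m hm⟩)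
      fun i m hm => ?_
    obtain ⟨hm, hmP⟩ := hN.mp hm
    refine hN.mpr ⟨apply_mem_wordSpan _ W i hm, fun g hg => ?_⟩
    rw [act_act]
    refine Submodule.add_mem _ ?_ (apply_mem_wordSpan _ W i (hmP g hg))
    have := hx g hg i
    generalize genBracket α β 0 g (x i) = y at this ⊢
    induction this using Submodule.span_induction with
    | mem y hy => obtain ⟨h, hh, rfl⟩ := hy; exact hmP h hh
    | zero => simp
    | add y z _ _ hy hz => rw [add_lie]; exact Submodule.add_mem _ hy hz
    | smul c y _ hy => rw [smul_lie]; exact Submodule.smul_mem _ c hy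
  exact (hN.mp (hle hw)).2 g hg

/-- The linear map from formal combinations of ordered monomials in `L_{-1}, L_{-2}, …`,
`J_{-d₂-1}, J_{-d₂-2}, …` and `G_{-d₁-1}, G_{-d₁-2}, …` with coefficients in `A`. -/
noncomputable def orderedMap {A : Type*} [AddCommGroup A] [Module ℂ A] (d₁ d₂ : ℕ)
    (e : A →ₗ[ℂ] M) :
    (Multiset ℕ →₀ Multiset ℕ →₀ Multiset ℕ →₀ A) →ₗ[ℂ] M :=
  monomialMap (lowL α β M) (monomialMap (lowJ α β M d₂) (monomialMap (lowG α β M d₁) e))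

theorem commutator_mem_span_lowL (i j : ℕ) :
    lowL α β M i * lowL α β M j - lowL α β M j * lowL α β M i ∈
      Submodule.span ℂ (Set.range (lowL α β M)) := by
  have : lowL α β M i * lowL α β M j - lowL α β M j * lowL α β M i =
      ((((-(i + 1) : ℤ) : ℂ)) - ((-(j + 1) : ℤ) : ℂ)) • lowL α β M (i + j + 1) := by
    ext m
    simp only [LinearMap.sub_apply, Module.End.mul_apply, LinearMap.smul_apply, lowL]
    rw [act_L_L, delta, if_neg (by omega), mul_zero, zero_smul, add_zero, add_sub_cancel_right,
      show (-((i : ℤ) + 1) + -((j : ℤ) + 1)) = -(((i + j + 1 : ℕ) : ℤ) + 1) by push_cast; ring]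
  rw [this]
  exact Submodule.smul_mem _ _ (Submodule.subset_span ⟨_, rfl⟩)

theorem commutator_mem_span_lowJ (d i j : ℕ) :
    lowJ α β M d i * lowJ α β M d j - lowJ α β M d j * lowJ α β M d i ∈
      Submodule.span ℂ (Set.range (lowJ α β M d)) := by
  have : lowJ α β M d i * lowJ α β M d j - lowJ α β M d j * lowJ α β M d i = 0 := by
    ext m
    simp only [LinearMap.sub_apply, Module.End.mul_apply, lowJ]
    rw [act_J_J, delta, if_neg (by omega), mul_zero, zero_smul, zero_add, sub_self,
      LinearMap.zero_apply]
  rw [this]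
  exact Submodule.zero_mem _

theorem commutator_mem_span_lowG (d i j : ℕ) :
    lowG α β M d i * lowG α β M d j - lowG α β M d j * lowG α β M d i ∈
      Submodule.span ℂ (Set.range (lowG α β M d)) := by
  have : lowG α β M d i * lowG α β M d j - lowG α β M d j * lowG α β M d i = 0 := by
    ext m
    simp only [LinearMap.sub_apply, Module.End.mul_apply, lowG]
    rw [act_G_G, sub_self, LinearMap.zero_apply]
  rw [this]
  exact Submodule.zero_mem _

/-- First enlargement: `𝓛_{(d₁,d₂)}` together with all `G_m`, where every bracket with a `G` is
again a multiple of a `G`. -/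
theorem act_mem_wordSpan_lowG {d₁ d₂ : ℕ} {W : Submodule ℂ M}
    (hW : ∀ g, InSub d₁ d₂ g → ∀ w ∈ W, act α β M g w ∈ W) {g : Gen}
    (hg : InSub d₁ d₂ g ∨ ∃ m, g = .G m) {w : M} (hw : w ∈ wordSpan (lowG α β M d₁) W) :
    act α β M g w ∈ wordSpan (lowG α β M d₁) W := by
  refine act_mem_wordSpan (P := fun g => InSub d₁ d₂ g ∨ ∃ m, g = .G m)
    (fun i => .G (-d₁ - (i + 1))) ?_ ?_ hg hw
  · intro g hg w hw
    by_cases h : InSub d₁ d₂ g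
    · exact le_wordSpan _ _ (hW g h w hw)
    · obtain ⟨m, rfl⟩ := hg.resolve_left h
      simp only [InSub, not_le] at h
      have := apply_mem_wordSpan (lowG α β M d₁) W (-d₁ - m - 1 : ℤ).toNat (le_wordSpan _ _ hw)
      rwa [lowG, show (-(d₁ : ℤ) - (((-d₁ - m - 1 : ℤ).toNat : ℤ) + 1)) = m by omega] at this
  · intro g hg i
    rcases g with m | m | m | _ | _ | _ <;> simp only [genBracket, zero_smul, Submodule.zero_mem]
    exact Submodule.smul_mem _ _ (Submodule.subset_span ⟨_, Or.inr ⟨_, rfl⟩, rfl⟩)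

/-- Second enlargement: everything except the `L_m` with `m < 0`. The third,
`act_mem_wordSpan_lowL`, reaches the whole algebra. -/
theorem act_mem_wordSpan_lowJ {d₁ d₂ : ℕ} {W : Submodule ℂ M}
    (hW : ∀ g, (InSub d₁ d₂ g ∨ ∃ m, g = .G m) → ∀ w ∈ W, act α β M g w ∈ W) {g : Gen}
    (hg : ∀ m, g = .L m → 0 ≤ m) {w : M} (hw : w ∈ wordSpan (lowJ α β M d₂) W) :
    act α β M g w ∈ wordSpan (lowJ α β M d₂) W := by
  refine act_mem_wordSpan (P := fun g => ∀ m, g = .L m → 0 ≤ m)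
    (fun i => .J (-d₂ - (i + 1))) ?_ ?_ hg hw
  · intro g hg w hw
    by_cases h : InSub d₁ d₂ g ∨ ∃ m, g = .G m
    · exact le_wordSpan _ _ (hW g h w hw)
    · rcases g with m | m | m | _ | _ | _
      · exact absurd (Or.inl (hg m rfl)) h
      · simp only [InSub, not_or, not_le] at h
        have := apply_mem_wordSpan (lowJ α β M d₂) W (-d₂ - m - 1 : ℤ).toNat (le_wordSpan _ _ hw)
        rwa [lowJ, show (-(d₂ : ℤ) - (((-d₂ - m - 1 : ℤ).toNat : ℤ) + 1)) = m by omega] at this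
      · exact absurd (Or.inr ⟨m, rfl⟩) h
      all_goals exact absurd (Or.inl trivial) h
  · have key : ∀ g, (∀ m, g = Gen.L m → 0 ≤ m) →
        gen α β 0 g ∈ Submodule.span ℂ (gen α β 0 '' {g | ∀ m, g = Gen.L m → 0 ≤ m}) :=
      fun g hg => Submodule.subset_span ⟨g, hg, rfl⟩
    intro g hg i
    rcases g with m | m | m | _ | _ | _ <;>
      simp only [genBracket, neg_zero, zero_smul, Submodule.zero_mem]
    · exact Submodule.sub_mem _ (Submodule.smul_mem _ _ (key _ (by simp)))
        (Submodule.smul_mem _ _ (key _ (by simp)))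
    · exact Submodule.smul_mem _ _ (key _ (by simp))

theorem act_mem_wordSpan_lowL {W : Submodule ℂ M}
    (hW : ∀ g, (∀ m, g = Gen.L m → 0 ≤ m) → ∀ w ∈ W, act α β M g w ∈ W) (g : Gen)
    {w : M} (hw : w ∈ wordSpan (lowL α β M) W) :
    act α β M g w ∈ wordSpan (lowL α β M) W := by
  refine act_mem_wordSpan (P := fun _ => True) (fun i => .L (-(i + 1))) ?_ ?_ trivial hw
  · intro g _ w hw
    by_cases h : ∀ m, g = .L m → 0 ≤ m
    · exact le_wordSpan _ _ (hW g h w hw)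
    · push Not at h
      obtain ⟨m, rfl, hm⟩ := h
      have := apply_mem_wordSpan (lowL α β M) W (-m - 1 : ℤ).toNat (le_wordSpan _ _ hw)
      rwa [lowL, show (-(((-m - 1 : ℤ).toNat : ℤ) + 1)) = m by omega] at this
  · intro g _ i
    have : {g : Gen | True} = Set.univ := rfl
    rw [this, Set.image_univ]
    exact (basis α β 0).mem_span _

/-- If the range of `e` is stable under `𝓛_{(d₁,d₂)}`, the span of the ordered monomials applied
to it is stable under the whole algebra. -/
theorem lie_mem_range_orderedMap {A : Type*} [AddCommGroup A] [Module ℂ A] {d₁ d₂ : ℕ}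
    {e : A →ₗ[ℂ] M}
    (he : ∀ g, InSub d₁ d₂ g → ∀ a, act α β M g (e a) ∈ LinearMap.range e)
    (x : Alg α β 0) {w : M} (hw : w ∈ LinearMap.range (orderedMap (α := α) (β := β) d₁ d₂ e)) :
    ⁅x, w⁆ ∈ LinearMap.range (orderedMap (α := α) (β := β) d₁ d₂ e) := by
  induction x using gen_induction with
  | hadd x y hx hy => rw [add_lie]; exact Submodule.add_mem _ hx hy
  | hsmul c x hx => rw [smul_lie]; exact Submodule.smul_mem _ c hx
  | hgen g =>
    rw [orderedMap, range_monomialMap commutator_mem_span_lowL,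
      range_monomialMap (commutator_mem_span_lowJ d₂),
      range_monomialMap (commutator_mem_span_lowG d₁)] at hw ⊢
    refine act_mem_wordSpan_lowL (fun g hg w hw => ?_) g hw
    refine act_mem_wordSpan_lowJ (d₁ := d₁) (fun g hg w hw => ?_) hg hw
    refine act_mem_wordSpan_lowG (d₂ := d₂) (fun g hg w hw => ?_) hg hw
    obtain ⟨a, rfl⟩ := hw
    exact he g hg a

end Spanning

end EHV

/-! ### Generation and Frobenius reciprocity for the induced module. -/

namespace InducedModule

attribute [local instance 100] LieRing.ofAssociativeRing

section Envelope

variable {R A : Type*} [CommRing R] [LieRing A] [LieAlgebra R A]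

/-- A subalgebra of the universal enveloping algebra containing the Lie algebra is everything. -/
theorem mem_of_forall_ι_mem (B : Subalgebra R (UniversalEnvelopingAlgebra R A))
    (hB : ∀ x, UniversalEnvelopingAlgebra.ι R x ∈ B) (u : UniversalEnvelopingAlgebra R A) :
    u ∈ B := by
  let j : A →ₗ⁅R⁆ B :=
    { toFun := fun x => ⟨UniversalEnvelopingAlgebra.ι R x, hB x⟩
      map_add' := fun x y => Subtype.ext (map_add _ x y)
      map_smul' := fun c x => Subtype.ext (map_smul _ c x)
      map_lie' := fun {x y} => Subtype.ext (by
        simp only [LieHom.map_lie, LieRing.of_associative_ring_bracket]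
        rfl) }
  -- By the universal property, the inclusion of `B` is split by the lift of `A → B`, so it is onto.
  have h : B.val.comp (UniversalEnvelopingAlgebra.lift R j) = AlgHom.id R _ := by
    ext x
    simp [j]
  have hu := congrArg (fun f : UniversalEnvelopingAlgebra R A →ₐ[R] _ => f u) h
  change ((UniversalEnvelopingAlgebra.lift R j u : B) : UniversalEnvelopingAlgebra R A) = u at hu
  exact hu ▸ (UniversalEnvelopingAlgebra.lift R j u).2

end Envelope

variable {R A : Type*} [CommRing R] [LieRing A] [LieAlgebra R A] (H : LieSubalgebra R A)
  (V : Type*) [AddCommGroup V] [Module R V] [LieRingModule H V] [LieModule R H V]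

/-- The canonical map `v ↦ 1 ⊗ v` from a module to the induced module. -/
noncomputable def incl : V →ₗ[R] Ind H V where
  toFun v := Submodule.Quotient.mk ((1 : UniversalEnvelopingAlgebra R A) ⊗ₜ[R] v)
  map_add' v w := by rw [TensorProduct.tmul_add]; rfl
  map_smul' c v := by rw [TensorProduct.tmul_smul]; rfl

variable {H V}

theorem mk_tmul (u : UniversalEnvelopingAlgebra R A) (v : V) :
    (Submodule.Quotient.mk (u ⊗ₜ[R] v) : Ind H V) = u • incl H V v := by
  change _ = Submodule.Quotient.mk (u • ((1 : UniversalEnvelopingAlgebra R A) ⊗ₜ[R] v))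
  rw [TensorProduct.smul_tmul', smul_eq_mul, mul_one]

theorem lie_incl (x : H) (v : V) : ⁅(x : A), incl H V v⁆ = incl H V ⁅x, v⁆ := by
  change UniversalEnvelopingAlgebra.ι R (x : A) • incl H V v = _
  rw [← mk_tmul]
  refine (Submodule.Quotient.eq _).mpr (Submodule.subset_span
    ⟨1, UniversalEnvelopingAlgebra.ι R x, v, ?_⟩)
  rw [envMap, envAct, UniversalEnvelopingAlgebra.lift_ι_apply,
    UniversalEnvelopingAlgebra.lift_ι_apply, one_mul]
  rfl

theorem eq_top_of_incl_mem {N : Submodule R (Ind H V)} (hincl : ∀ v, incl H V v ∈ N)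
    (hN : ∀ (x : A), ∀ w ∈ N, ⁅x, w⁆ ∈ N) : N = ⊤ := by
  let B : Subalgebra R (UniversalEnvelopingAlgebra R A) :=
    { carrier := {u | ∀ w ∈ N, u • w ∈ N}
      mul_mem' := fun {a b} ha hb w hw => by rw [mul_smul]; exact ha _ (hb w hw)
      add_mem' := fun {a b} ha hb w hw => by
        rw [add_smul]; exact N.add_mem (ha w hw) (hb w hw)
      algebraMap_mem' := fun r w hw => by
        rw [algebraMap_smul]; exact N.smul_mem r hw }
  have hB : ∀ u, u ∈ B := mem_of_forall_ι_mem B fun x w hw => hN x w hw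
  rw [eq_top_iff]
  intro w _
  obtain ⟨t, rfl⟩ := Submodule.Quotient.mk_surjective _ w
  induction t using TensorProduct.induction_on with
  | zero => exact N.zero_mem
  | tmul u v => rw [mk_tmul]; exact hB u _ (hincl v)
  | add s t hs ht => exact N.add_mem (hs trivial) (ht trivial)

section Lift

variable {S : Type*} [AddCommGroup S] [Module R S] [LieRingModule A S] [LieModule R A S]

/-- The action of the universal enveloping algebra on a module. -/
noncomputable def envAction (R A S : Type*) [CommRing R] [LieRing A] [LieAlgebra R A]
    [AddCommGroup S] [Module R S] [LieRingModule A S] [LieModule R A S] :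
    UniversalEnvelopingAlgebra R A →ₐ[R] Module.End R S :=
  UniversalEnvelopingAlgebra.lift R (LieModule.toEnd R A S)

theorem envAction_ι (x : A) (s : S) :
    envAction R A S (UniversalEnvelopingAlgebra.ι R x) s = ⁅x, s⁆ := by
  rw [envAction, UniversalEnvelopingAlgebra.lift_ι_apply]
  rfl

/-- The elements `h` for which this holds form a subalgebra, so it is enough to treat the
generators, where it is `hf`. -/
theorem envAction_envMap (f : V →ₗ[R] S) (hf : ∀ (x : H) v, f ⁅x, v⁆ = ⁅(x : A), f v⁆)
    (h : UniversalEnvelopingAlgebra R H) (v : V) :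
    envAction R A S (envMap H h) (f v) = f (envAct H V h v) := by
  let B : Subalgebra R (UniversalEnvelopingAlgebra R H) :=
    { carrier := {h | ∀ v, envAction R A S (envMap H h) (f v) = f (envAct H V h v)}
      mul_mem' := fun {a b} ha hb v => by
        simp only [map_mul, Module.End.mul_apply, hb v, ha (envAct H V b v)]
      add_mem' := fun {a b} ha hb v => by
        simp only [map_add, LinearMap.add_apply, ha v, hb v]
      algebraMap_mem' := fun r v => by simp [Module.algebraMap_end_apply] }
  refine mem_of_forall_ι_mem B (fun x v => ?_) h v
  rw [envMap, envAct, UniversalEnvelopingAlgebra.lift_ι_apply,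
    UniversalEnvelopingAlgebra.lift_ι_apply]
  exact (envAction_ι _ _).trans (hf x v).symm

/-- The map `u ⊗ v ↦ u (f v)`. -/
noncomputable def preLift (f : V →ₗ[R] S) : UniversalEnvelopingAlgebra R A ⊗[R] V →ₗ[R] S :=
  TensorProduct.lift ((LinearMap.lcomp R S f) ∘ₗ (envAction R A S).toLinearMap)

theorem preLift_tmul (f : V →ₗ[R] S) (u : UniversalEnvelopingAlgebra R A) (v : V) :
    preLift f (u ⊗ₜ[R] v) = envAction R A S u (f v) := rfl

theorem preLift_smul (f : V →ₗ[R] S) (u : UniversalEnvelopingAlgebra R A)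
    (t : UniversalEnvelopingAlgebra R A ⊗[R] V) :
    preLift f (u • t) = envAction R A S u (preLift f t) := by
  induction t using TensorProduct.induction_on with
  | zero => simp
  | tmul w v =>
    rw [TensorProduct.smul_tmul', smul_eq_mul, preLift_tmul, preLift_tmul, map_mul]
    rfl
  | add s t hs ht => rw [smul_add, map_add, map_add, map_add, hs, ht]

/-- Frobenius reciprocity: a map of `H`-modules from `V` to an `A`-module extends to the induced
module. -/
noncomputable def lift (f : V →ₗ[R] S) (hf : ∀ (x : H) v, f ⁅x, v⁆ = ⁅(x : A), f v⁆) :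
    Ind H V →ₗ⁅R, A⁆ S :=
  { toLinearMap := ((relations H V).restrictScalars R).liftQ (preLift f) (by
      intro t ht
      change t ∈ relations H V at ht
      rw [LinearMap.mem_ker]
      induction ht using Submodule.span_induction with
      | mem t ht =>
        obtain ⟨u, h, v, rfl⟩ := ht
        rw [map_sub, preLift_tmul, preLift_tmul, map_mul, Module.End.mul_apply,
          envAction_envMap f hf, sub_self]
      | zero => exact map_zero _
      | add s t _ _ hs ht => rw [map_add, hs, ht, add_zero]
      | smul u t _ ht => rw [preLift_smul, ht, map_zero])
    map_lie' := by
      intro x w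
      obtain ⟨t, rfl⟩ := Submodule.Quotient.mk_surjective _ w
      exact (preLift_smul f _ t).trans (envAction_ι x _) }

theorem lift_incl (f : V →ₗ[R] S) (hf : ∀ (x : H) v, f ⁅x, v⁆ = ⁅(x : A), f v⁆) (v : V) :
    lift f hf (incl H V v) = f v := by
  change envAction R A S 1 (f v) = f v
  rw [map_one]
  rfl

end Lift

end InducedModule

/-! ### The subspace `annihilated`, its simplicity and the isomorphism with the induced module. -/

namespace EHV

open OrderedMonomials InducedModule

variable {α β : ℂ}

section

variable {M : Type*} [AddCommGroup M] [Module ℂ M] [LieRingModule (Alg α β 0) M]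
  [LieModule ℂ (Alg α β 0) M]

theorem lie_C₂ (x : Alg α β 0) : ⁅gen α β 0 .C₂, x⁆ = 0 := by
  induction x using gen_induction with
  | hadd x y hx hy => rw [lie_add, hx, hy, add_zero]
  | hsmul c x hx => rw [lie_smul, hx, smul_zero]
  | hgen g => rw [lie_def, bracket_gen, genBracket] <;> simp

theorem lie_C₁ (x : Alg α β 0) : ⁅gen α β 0 .C₁, x⁆ = 0 := by
  induction x using gen_induction with
  | hadd x y hx hy => rw [lie_add, hx, hy, add_zero]
  | hsmul c x hx => rw [lie_smul, hx, smul_zero]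
  | hgen g => rw [lie_def, bracket_gen, genBracket] <;> simp

instance : Countable Gen := by
  let f : Gen → ℕ × ℤ := fun g => match g with
    | .L m => (0, m)
    | .J m => (1, m)
    | .G m => (2, m)
    | .C₁ => (3, 0)
    | .C₂ => (4, 0)
    | .C₃ => (5, 0)
  refine Function.Injective.countable (f := f) fun g h hgh => ?_
  cases g <;> cases h <;> simp_all [f]

theorem exists_act_eq_smul_of_central [LieModule.IsIrreducible ℂ (Alg α β 0) M] {g : Gen}
    (hg : ∀ x : Alg α β 0, ⁅gen α β 0 g, x⁆ = 0) : ∃ c : ℂ, ∀ m : M, act α β M g m = c • m := by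
  let T : M →ₗ⁅ℂ, Alg α β 0⁆ M :=
    { act α β M g with
      map_lie' := by
        intro x m
        change ⁅gen α β 0 g, ⁅x, m⁆⁆ = ⁅x, ⁅gen α β 0 g, m⁆⁆
        rw [leibniz_lie, hg, zero_lie, zero_add] }
  exact exists_eq_smul_of_isIrreducible _ (basis α β 0).span_eq T

/-- The vectors killed by `G_{k+i}, J_{d₂+i}, L_{k+d₁+i}` for all `i ≥ 1`. -/
def annihilated (α β : ℂ) (M : Type*) [AddCommGroup M] [Module ℂ M] [LieRingModule (Alg α β 0) M]
    [LieModule ℂ (Alg α β 0) M] (k d₁ d₂ : ℕ) : Submodule ℂ M :=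
  killed α β M .G k ⊓ killed α β M .J d₂ ⊓ killed α β M .L (k + d₁)

theorem act_mem_annihilated {k d₁ d₂ : ℕ} (hd : 2 * d₂ ≤ k + d₁) {g : Gen} (hg : InSub d₁ d₂ g)
    (hC : ∀ m : M, m ∈ annihilated α β M k d₁ d₂ → ∀ h : Gen, h = .C₁ ∨ h = .C₂ ∨ h = .C₃ →
      act α β M h m ∈ annihilated α β M k d₁ d₂)
    {v : M} (hv : v ∈ annihilated α β M k d₁ d₂) :
    act α β M g v ∈ annihilated α β M k d₁ d₂ := by
  obtain ⟨⟨hG, hJ⟩, hL⟩ := id hv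
  rcases g with m | m | m | _ | _ | _
  · simp only [InSub] at hg
    refine ⟨⟨fun n hn => ?_, fun n hn => ?_⟩, fun n hn => ?_⟩
    · rw [act_G_L, hG n hn, hG _ (by omega), map_zero, smul_zero, add_zero]
    · have h := act_L_J (α := α) (β := β) m n v
      rw [hJ n hn, hJ _ (by omega), delta, if_neg (by omega), map_zero, smul_zero, mul_zero,
        zero_smul, sub_zero, zero_add] at h
      exact h.symm
    · rw [act_L_L, hL n hn, hL _ (by omega), delta, if_neg (by omega), map_zero, smul_zero,
        mul_zero, zero_smul, add_zero, add_zero]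
  · simp only [InSub] at hg
    refine ⟨⟨fun n hn => ?_, fun n hn => ?_⟩, fun n hn => ?_⟩
    · rw [← act_J_G, hG n hn, map_zero]
    · rw [act_J_J, hJ n hn, delta, if_neg (by omega), map_zero, mul_zero, zero_smul, add_zero]
    -- The only place for `hd`: with `n > k + d₁` and `m ≥ -d₂`, it gives `m + n > d₂`.
    · rw [act_L_J, hL n hn, hJ _ (by omega), delta, if_neg (by omega), map_zero, smul_zero,
        mul_zero, zero_smul, sub_zero, add_zero]
  · simp only [InSub] at hg
    refine ⟨⟨fun n hn => ?_, fun n hn => ?_⟩, fun n hn => ?_⟩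
    · rw [act_G_G, hG n hn, map_zero]
    · rw [act_J_G, hJ n hn, map_zero]
    · rw [act_L_G, hL n hn, hG _ (by omega), map_zero, smul_zero, add_zero]
  all_goals exact hC v hv _ (by simp)

/-- The three independence results are nested, each with coefficients in the previous range. The
order of the factors matters: `G`-monomials keep vectors in `killed .J`, since `J` and `G` commute,
and `J`- and `G`-monomials keep them in `killed .G`, which is what the next differentiation
requires. -/
theorem injective_orderedMap (hαβ : ∀ n m : ℤ, n ≠ 0 → m ≠ 0 → α + n + m * β ≠ 0) {k d₁ d₂ : ℕ}
    (hd₁ : 2 ≤ d₁) (hk : ∀ v ∈ killed α β M .G k, act α β M (.G k) v = 0 → v = 0)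
    {ℓ : ℂ} (hℓ : ℓ ≠ 0) (hC : ∀ v : M, act α β M .C₃ v = ℓ • v)
    {A : Type*} [AddCommGroup A] [Module ℂ A] {e : A →ₗ[ℂ] M} (he : Function.Injective e)
    (heV : ∀ a, e a ∈ annihilated α β M k d₁ d₂) :
    Function.Injective (orderedMap (α := α) (β := β) d₁ d₂ e) := by
  have range_le : ∀ {B : Type _} [AddCommGroup B] [Module ℂ B] {X : ℕ → Module.End ℂ M}
      {e : B →ₗ[ℂ] M} {U : Submodule ℂ M}, (∀ i, ∀ u ∈ U, X i u ∈ U) → (∀ b, e b ∈ U) →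
      ∀ f, monomialMap X e f ∈ U := by
    intro B _ _ X e U hX he f
    exact Submodule.sum_mem _ fun l _ => wordSpan_le (le_refl U) hX
      (Submodule.subset_span ⟨_, _, he _, rfl⟩)
  have hG := (differentiates_lowG hαβ hd₁ hk).injective_monomialMap he
    fun a => ⟨(heV a).1.1, (heV a).2⟩
  have hJ := (differentiates_lowJ hℓ hC d₂).injective_monomialMap hG
    (range_le (fun i u hu => act_G_mem_killed_J _ hu) fun a => (heV a).1.2)
  exact (differentiates_lowL hαβ hk).injective_monomialMap hJ
    (range_le (fun i u hu => act_J_mem_killed_G _ hu)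
      (range_le (fun i u hu => act_G_mem_killed_G _ hu) fun a => (heV a).1.1))

theorem comp_orderedMap {N A : Type*} [AddCommGroup N] [Module ℂ N] [LieRingModule (Alg α β 0) N]
    [LieModule ℂ (Alg α β 0) N] [AddCommGroup A] [Module ℂ A] (d₁ d₂ : ℕ) (e : A →ₗ[ℂ] M)
    (φ : M →ₗ⁅ℂ, Alg α β 0⁆ N) :
    (φ : M →ₗ[ℂ] N) ∘ₗ orderedMap (α := α) (β := β) d₁ d₂ e =
      orderedMap (α := α) (β := β) d₁ d₂ ((φ : M →ₗ[ℂ] N) ∘ₗ e) := by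
  rw [orderedMap, orderedMap, comp_monomialMap (Y := lowL α β N) _ _ fun i m => φ.map_lie _ m,
    comp_monomialMap (Y := lowJ α β N d₂) _ _ fun i m => φ.map_lie _ m,
    comp_monomialMap (Y := lowG α β N d₁) _ _ fun i m => φ.map_lie _ m]

theorem orderedMap_comp {A B : Type*} [AddCommGroup A] [Module ℂ A] [AddCommGroup B] [Module ℂ B]
    (d₁ d₂ : ℕ) (e : A →ₗ[ℂ] M) (g : B →ₗ[ℂ] A) :
    orderedMap (α := α) (β := β) d₁ d₂ (e ∘ₗ g) =
      orderedMap (α := α) (β := β) d₁ d₂ e ∘ₗ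
        Finsupp.mapRange.linearMap (Finsupp.mapRange.linearMap (Finsupp.mapRange.linearMap g)) := by
  simp only [orderedMap, monomialMap_comp]

theorem orderedMap_single {A : Type*} [AddCommGroup A] [Module ℂ A] (d₁ d₂ : ℕ) (e : A →ₗ[ℂ] M)
    (a : A) : orderedMap (α := α) (β := β) d₁ d₂ e
      (Finsupp.single 0 (Finsupp.single 0 (Finsupp.single 0 a))) = e a := by
  simp only [orderedMap, monomialMap_single_zero]

/-- In an irreducible module, ordered monomials applied to a nonzero `𝓛_{(d₁,d₂)}`-stable subspace
span everything. -/
theorem surjective_orderedMap [LieModule.IsIrreducible ℂ (Alg α β 0) M]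
    {A : Type*} [AddCommGroup A] [Module ℂ A] {d₁ d₂ : ℕ} {e : A →ₗ[ℂ] M}
    (he : ∀ g, InSub d₁ d₂ g → ∀ a, act α β M g (e a) ∈ LinearMap.range e) {a : A}
    (ha : e a ≠ 0) : Function.Surjective (orderedMap (α := α) (β := β) d₁ d₂ e) := by
  let N : LieSubmodule ℂ (Alg α β 0) M :=
    { LinearMap.range (orderedMap (α := α) (β := β) d₁ d₂ e) with
      lie_mem := fun {x _} hm => lie_mem_range_orderedMap he x hm }
  have hN : N = ⊤ := by
    refine (eq_bot_or_eq_top N).resolve_left fun h => ha ?_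
    have : e a ∈ N := ⟨_, orderedMap_single d₁ d₂ e a⟩
    rwa [h, LieSubmodule.mem_bot] at this
  intro m
  have : m ∈ N := hN ▸ LieSubmodule.mem_top m
  exact this

end

theorem lie_mem_of_forall_gen {M : Type*} [AddCommGroup M] [Module ℂ M]
    [LieRingModule (Alg α β 0) M] [LieModule ℂ (Alg α β 0) M] {d₁ d₂ : ℕ} {W : Submodule ℂ M}
    (hW : ∀ g, InSub d₁ d₂ g → ∀ w ∈ W, act α β M g w ∈ W) {x : Alg α β 0}
    (hx : x ∈ sub α β d₁ d₂) {w : M} (hw : w ∈ W) : ⁅x, w⁆ ∈ W := by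
  change x ∈ Submodule.span ℂ (gen α β 0 '' {g | InSub d₁ d₂ g}) at hx
  induction hx using Submodule.span_induction with
  | mem x hx => obtain ⟨g, hg, rfl⟩ := hx; exact hW g hg w hw
  | zero => rw [zero_lie]; exact W.zero_mem
  | add x y _ _ hx hy => rw [add_lie]; exact W.add_mem hx hy
  | smul c x _ hx => rw [smul_lie]; exact W.smul_mem c hx

section

variable {S : Type*} [AddCommGroup S] [Module ℂ S] [LieRingModule (Alg α β 0) S]
  [LieModule ℂ (Alg α β 0) S] [LieModule.IsIrreducible ℂ (Alg α β 0) S] {d₁ d₂ : ℕ}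
  (V : LieSubmodule ℂ (sub α β d₁ d₂) S)

/-- Monomials applied to a nonzero submodule `N` of `V` already span `S`. A vector of `V` is thus a
combination of monomials with coefficients in `N`, and by independence over `V` it equals the
coefficient of the empty monomial. -/
theorem isIrreducible_of_injective_orderedMap [Nontrivial V]
    (hinj : Function.Injective
      (orderedMap (α := α) (β := β) d₁ d₂ (V.toSubmodule.subtype))) :
    LieModule.IsIrreducible ℂ (sub α β d₁ d₂) V := by
  refine LieModule.IsIrreducible.mk fun N hN => ?_
  obtain ⟨a, haN, ha⟩ : ∃ a ∈ N, a ≠ 0 := by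
    by_contra! h
    exact hN ((LieSubmodule.eq_bot_iff N).mpr h)
  have hsurj := surjective_orderedMap (α := α) (β := β) (d₁ := d₁) (d₂ := d₂)
    (e := V.toSubmodule.subtype ∘ₗ N.toSubmodule.subtype) (a := ⟨a, haN⟩) ?_
    (fun h => ha (Subtype.ext h))
  · rw [eq_top_iff]
    intro v _
    obtain ⟨p, hp⟩ := hsurj (v : S)
    rw [orderedMap_comp] at hp
    have h := hinj (hp.trans (orderedMap_single (α := α) (β := β) d₁ d₂
      V.toSubmodule.subtype v).symm)
    have h0 := congrArg (fun q => q 0 0 0) h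
    simp only [Finsupp.mapRange.linearMap_apply, Finsupp.mapRange_apply,
      Finsupp.single_eq_same] at h0
    rw [← h0]
    exact (p 0 0 0).2
  · rintro g hg ⟨⟨w, hw⟩, hwN⟩
    exact ⟨⟨_, N.lie_mem (x := subGen α β d₁ d₂ g hg) hwN⟩, rfl⟩

/-- Monomials over `V` span `Ind V`, and the canonical map `φ` carries them to the corresponding
monomials of `S`, which are independent; hence `φ` is injective. It is surjective because `S` is
simple. -/
theorem nonempty_equiv_ind_of_injective_orderedMap [Nontrivial V]
    (hinj : Function.Injective
      (orderedMap (α := α) (β := β) d₁ d₂ (V.toSubmodule.subtype))) :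
    Nonempty (S ≃ₗ⁅ℂ, Alg α β 0⁆ Ind (sub α β d₁ d₂) V) := by
  let φ : Ind (sub α β d₁ d₂) V →ₗ⁅ℂ, Alg α β 0⁆ S :=
    lift (V.toSubmodule.subtype) fun x v => rfl
  have hφ : (φ : _ →ₗ[ℂ] S) ∘ₗ incl (sub α β d₁ d₂) V = V.toSubmodule.subtype :=
    LinearMap.ext fun v =>
      lift_incl (H := sub α β d₁ d₂) (V := V) V.toSubmodule.subtype (fun x v => rfl) v
  have hcomp := comp_orderedMap d₁ d₂ (incl (sub α β d₁ d₂) V) φ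
  rw [hφ] at hcomp
  have hrange : LinearMap.range (orderedMap (α := α) (β := β) d₁ d₂
      (incl (sub α β d₁ d₂) V)) = ⊤ := by
    refine eq_top_of_incl_mem (fun v => ⟨_, orderedMap_single d₁ d₂ _ v⟩) fun x w hw => ?_
    refine lie_mem_range_orderedMap (fun g hg v => ?_) x hw
    exact ⟨_, (lie_incl (subGen α β d₁ d₂ g hg) v).symm⟩
  have hφinj : Function.Injective φ := by
    rw [injective_iff_map_eq_zero]
    intro w hw
    obtain ⟨p, rfl⟩ := LinearMap.range_eq_top.mp hrange w
    have h := LinearMap.congr_fun hcomp p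
    rw [hinj (a₁ := p) (a₂ := 0) (by rw [← h, map_zero]; exact hw), map_zero]
  have hφsurj : Function.Surjective φ := by
    obtain ⟨v, hv⟩ := exists_ne (0 : V)
    have hsurj := surjective_orderedMap (α := α) (β := β) (d₁ := d₁) (d₂ := d₂)
      (e := V.toSubmodule.subtype) (a := v)
      (fun g hg v => ⟨⟨_, V.lie_mem (x := subGen α β d₁ d₂ g hg) v.2⟩, rfl⟩)
      (fun h => hv (Subtype.ext h))
    intro s
    obtain ⟨p, rfl⟩ := hsurj s
    exact ⟨_, LinearMap.congr_fun hcomp p⟩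
  exact ⟨LieModuleEquiv.symm
    { toLieModuleHom := φ
      invFun := Function.surjInv hφsurj
      left_inv := Function.leftInverse_surjInv ⟨hφinj, hφsurj⟩
      right_inv := Function.rightInverse_surjInv hφsurj }⟩

end

end EHV

/-! ### Choice of `k`, `d₁`, `d₂` and `V`. -/

theorem mainTheorem6 (α β : ℂ)
    (hαβ : ∀ n m : ℤ, n ≠ 0 → m ≠ 0 → α + n + m * β ≠ 0)
    (S : Type u) [AddCommGroup S] [Module ℂ S] [LieRingModule (EHV.Alg α β 0) S]
    [LieModule ℂ (EHV.Alg α β 0) S]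
    (hsimple : LieModule.IsIrreducible ℂ (EHV.Alg α β 0) S)
    (hrestricted : EHV.IsRestricted α β 0 S)
    (hC₃ : ∃ ℓ₃ : ℂ, ℓ₃ ≠ 0 ∧ ∀ w : S, ⁅EHV.C₃ α β 0, w⁆ = ℓ₃ • w)
    (hG : ∃ a : ℕ, Function.Injective fun w : S => ⁅EHV.G α β 0 (a : ℤ), w⁆) :
    ∃ (d₁ d₂ : ℕ) (V : Type u) (_ : AddCommGroup V) (_ : Module ℂ V)
      (_ : LieRingModule (EHV.sub α β d₁ d₂) V) (_ : LieModule ℂ (EHV.sub α β d₁ d₂) V),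
      LieModule.IsIrreducible ℂ (EHV.sub α β d₁ d₂) V ∧
      EHV.HasLevel α β d₁ d₂ V ∧
      EHV.InducingConditions α β d₁ d₂ V ∧
      Nonempty (S ≃ₗ⁅ℂ, EHV.Alg α β 0⁆ InducedModule.Ind (EHV.sub α β d₁ d₂) V) := by
  classical
  have : Nontrivial S := (LieSubmodule.nontrivial_iff ℂ (EHV.Alg α β 0) S).mp inferInstance
  obtain ⟨ℓ₃, hℓ₃, hC₃⟩ := hC₃
  obtain ⟨ℓ₁, hC₁⟩ := EHV.exists_act_eq_smul_of_central (M := S) (EHV.lie_C₁ (α := α) (β := β))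
  obtain ⟨ℓ₂, hC₂⟩ := EHV.exists_act_eq_smul_of_central (M := S) (EHV.lie_C₂ (α := α) (β := β))
  obtain ⟨a, ha⟩ := hG
  have hex : ∃ k : ℕ, ∃ w ∈ EHV.killed α β S .G k, w ≠ 0 := by
    obtain ⟨w, hw⟩ := exists_ne (0 : S)
    obtain ⟨N, hN⟩ := hrestricted w
    exact ⟨N.toNat, w, fun m hm => (hN m (by omega)).2.2, hw⟩
  obtain ⟨k, ⟨w, hwG, hw⟩, hmin⟩ : ∃ k : ℕ, (∃ w ∈ EHV.killed α β S .G k, w ≠ 0) ∧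
      ∀ j < k, ¬∃ w ∈ EHV.killed α β S .G j, w ≠ 0 :=
    ⟨Nat.find hex, Nat.find_spec hex, fun j hj => Nat.find_min hex hj⟩
  have hk : ∀ v ∈ EHV.killed α β S .G k, EHV.act α β S (.G k) v = 0 → v = 0 := by
    intro v hv hv0
    have hge : ∀ m : ℤ, k ≤ m → EHV.act α β S (.G m) v = 0 := by
      intro m hm
      rcases hm.eq_or_lt with rfl | hm
      · exact hv0
      · exact hv m hm
    by_contra hne
    -- Minimality gives nothing at `k = 0`. There `v` is killed by every `G_m` with `m ≥ 0`, in
    -- particular by the injective `G_a`.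
    rcases Nat.eq_zero_or_pos k with rfl | hpos
    · exact hne (ha ((hge a (by omega)).trans (lie_zero _).symm))
    · exact hmin (k - 1) (by omega) ⟨v, fun m hm => hge m (by omega), hne⟩
  obtain ⟨N, hN⟩ := hrestricted w
  let d₂ : ℕ := N.toNat
  -- Large enough for both `2 ≤ d₁`, needed to differentiate `lowG`, and `2 * d₂ ≤ k + d₁`, needed
  -- for stability.
  let d₁ : ℕ := 2 + 2 * N.toNat
  have hwV : w ∈ EHV.annihilated α β S k d₁ d₂ :=
    ⟨⟨hwG, fun m hm => (hN m (by omega)).2.1⟩, fun m hm => (hN m (by omega)).1⟩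
  have hstable : ∀ g, EHV.InSub d₁ d₂ g → ∀ v ∈ EHV.annihilated α β S k d₁ d₂,
      EHV.act α β S g v ∈ EHV.annihilated α β S k d₁ d₂ := by
    intro g hg v hv
    refine EHV.act_mem_annihilated (by omega) hg (fun m hm h hh => ?_) hv
    rcases hh with rfl | rfl | rfl
    · rw [hC₁]; exact Submodule.smul_mem _ _ hm
    · rw [hC₂]; exact Submodule.smul_mem _ _ hm
    · rw [show EHV.act α β S .C₃ m = ℓ₃ • m from hC₃ m]; exact Submodule.smul_mem _ _ hm
  let V : LieSubmodule ℂ (EHV.sub α β d₁ d₂) S :=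
    { EHV.annihilated α β S k d₁ d₂ with
      lie_mem := fun {x _} hm => EHV.lie_mem_of_forall_gen hstable x.2 hm }
  have : Nontrivial V := ⟨⟨w, hwV⟩, 0, fun h => hw (congrArg Subtype.val h)⟩
  have hinj := EHV.injective_orderedMap hαβ (d₁ := d₁) (d₂ := d₂) (by omega) hk hℓ₃ hC₃
    (e := V.toSubmodule.subtype) Subtype.val_injective fun v => v.2
  refine ⟨d₁, d₂, V, inferInstance, inferInstance, inferInstance, inferInstance,
    EHV.isIrreducible_of_injective_orderedMap V hinj, ⟨ℓ₁, ℓ₂, ℓ₃, hℓ₃, fun v =>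
      ⟨Subtype.ext (hC₁ v), Subtype.ext (hC₂ v), Subtype.ext (hC₃ v)⟩⟩, ⟨k, ?_, fun i hi v => ?_⟩,
    EHV.nonempty_equiv_ind_of_injective_orderedMap V hinj⟩
  · intro v v' h
    have h' : EHV.act α β S (.G k) v = EHV.act α β S (.G k) v' := congrArg Subtype.val h
    refine Subtype.ext (sub_eq_zero.mp (hk _ (Submodule.sub_mem _ v.2.1.1 v'.2.1.1) ?_))
    rw [map_sub, h', sub_self]
  · exact ⟨Subtype.ext (v.2.1.1 _ (by omega)), Subtype.ext (v.2.1.2 _ (by omega)),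
      Subtype.ext (v.2.2 _ (by omega))⟩
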